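/- **Setting.** Let $\mathcal X,\mathcal Y$ be measurable spaces, $P$ a probability measure on $\mathcal X\times\mathcal Y$, and $\bar{\mathcal Y}\subset\mathbb R$ a convex set. Let $\bar\ell:\bar{\mathcal Y}\times\mathcal Y\to\mathbb R$ and $L>0$ be such that for every $y\in\mathcal Y$ the function $\bar\ell(\cdot,y)$ is convex and $L$-Lipschitz. Let $F$ be a convex class of measurable functions $f:\mathcal X\to\bar{\mathcal Y}$ such that every $\ell_f(x,y)=\bar\ell(f(x),y)$ is measurable. Let $f^*\in F$ be an oracle: $\mathcal L_f=\ell_f-\ell_{f^*}$ is $P$-integrable (which is automatic if $F\subset L_1(P)$) and $P\mathcal L_f\ge 0$ for every $f\in F$. So that suprema over $F$ are measurable, $F$ is assumed separable: there is a countable $F_0\subset F$ such that every $f\in F$ is the pointwise limit of a sequence $(f_n)$ in $F_0$ with $P\mathcal L_{f_n}\to P\mathcal L_f$. **Data.** Let $(X_i,Y_i)_{i=1}^N$ be data in $\mathcal X\times\mathcal Y$, defined on a common probability space, and let $\mathcal O\sqcup\mathcal I=\{1,\dots,N\}$. Nothing is assumed on the outliers $(X_i,Y_i)_{i\in\mathcal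 O}$. The inliers $(X_i,Y_i)_{i\in\mathcal I}$ are independent random variables and, with $P_i$ the law of $(X_i,Y_i)$ and $\mu_i$ that of $X_i$, they satisfy $F\subset L_2(\mu_i)$ and $P_i\mathcal L_f=P\mathcal L_f$ for all $i\in\mathcal I$ and $f\in F$. Assume $|\mathcal O|\le 3N/7$. **Estimator.** Let $K\ge1$ be an integer with $7|\mathcal O|/3\le K\le N$, and let $B_1,\dots,B_K\subset\{1,\dots,N\}$ be disjoint blocks of equal size $\lfloor N/K\rfloor$. The data outside the blocks are discarded (there are none if $K$ divides $N$): put $N'=K\lfloor N/K\rfloor$ and $\mathcal I'=\mathcal I\cap\bigcup_kB_k$, so $N'=N$ and $\mathcal I'=\mathcal I$ if $K\mid N$. For $g:\mathcal X\times\mathcal Y\to\mathbb R$ let $\mathrm{MOM}_K(g)$ be a median of the block means $|B_k|^{-1}\sum_{i\in B_k}g(X_i,Y_i)$, $k=1,\dots,K$, selected by any fixed rule. A minmax MOM estimator is any $$\hat f\in\operatorname*{argmin}_{f\in F}\ \sup_{g\in F}\ \mathrm{MOM}_K(\ell_f-\ell_g).$$ **Complexity.** Let $(\sigma_i)$ be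 i.i.d. uniform signs in $\{-1,1\}$, independent of the data. For $r>0$ let $$E(r)=\sup_{J\subset\mathcal I',\,|J|\ge N'/2}\ \mathbb E\sup_{f\in F:\,P\mathcal L_f\le r^2}\Big|\frac1{|J|}\sum_{i\in J}\sigma_i(f-f^*)(X_i)\Big|,$$ $$V_K(r)=\max_{i\in\mathcal I'}\ \sup_{f\in F:\,P\mathcal L_f\le r^2}\sqrt{\operatorname{Var}_{P_i}(\mathcal L_f)}\ \sqrt{K/N'} .$$ Let $\gamma=1/(768L)$ and let $\bar r_2(\gamma)\in[0,\infty)$ be any number with $$\bar r_2(\gamma)\ \ge\ \inf\Big\{r>0:\ \max\Big(\frac{E(r)}{\gamma},\ \sqrt{1536}\,V_K(r)\Big)\le r^2\Big\}\qquad(\inf\emptyset=+\infty).$$ **Theorem.** There is an event of probability at least $1-\exp(-K/2016)$ on which every minmax MOM estimator $\hat f$ satisfies $$P\mathcal L_{\hat f}\ \le\ \bar r_2^2(\gamma).$$ -/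

import Mathlib

open MeasureTheory ProbabilityTheory Filter Topology
open scoped ENNReal

noncomputable section

namespace MinmaxMOM

/-- The difference of losses `ℓ_f - ℓ_g`, where `ℓ_f (x, y) = ℓ (f x) y`.
The excess loss of `f` is `lossDiff ℓ f fs`, with `fs` the oracle. -/
def lossDiff {𝒳 𝒴 : Type*} (ℓ : ℝ → 𝒴 → ℝ) (f g : 𝒳 → ℝ) (z : 𝒳 × 𝒴) : ℝ :=
  ℓ (f z.1) z.2 - ℓ (g z.1) z.2

/-- The excess risk `P (ℓ_f - ℓ_{fs})`. -/
def excessRisk {𝒳 𝒴 : Type*} [MeasurableSpace 𝒳] [MeasurableSpace 𝒴]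
    (ℓ : ℝ → 𝒴 → ℝ) (P : Measure (𝒳 × 𝒴)) (fs f : 𝒳 → ℝ) : ℝ :=
  ∫ z, lossDiff ℓ f fs z ∂P

/-- `fs` minimizes over `F` the risk, defined up to an additive constant through the differences
`ℓ_f - ℓ_{fs}`, which are required to be `P`-integrable (the losses themselves need not be). -/
structure IsOracle {𝒳 𝒴 : Type*} [MeasurableSpace 𝒳] [MeasurableSpace 𝒴]
    (ℓ : ℝ → 𝒴 → ℝ) (P : Measure (𝒳 × 𝒴)) (F : Set (𝒳 → ℝ)) (fs : 𝒳 → ℝ) : Prop where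
  mem : fs ∈ F
  integrable : ∀ f ∈ F, Integrable (lossDiff ℓ f fs) P
  le : ∀ f ∈ F, 0 ≤ excessRisk ℓ P fs f

/-- Separability of the class `F`: some countable subset of `F` approximates every `f ∈ F`
pointwise, with convergence of the excess risks. It makes suprema over `F` measurable. -/
def IsSeparableClass {𝒳 𝒴 : Type*} [MeasurableSpace 𝒳] [MeasurableSpace 𝒴]
    (ℓ : ℝ → 𝒴 → ℝ) (P : Measure (𝒳 × 𝒴)) (F : Set (𝒳 → ℝ)) (fs : 𝒳 → ℝ) : Prop :=
  ∃ F₀ : Set (𝒳 → ℝ), F₀ ⊆ F ∧ F₀.Countable ∧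
    ∀ f ∈ F, ∃ u : ℕ → 𝒳 → ℝ, (∀ n, u n ∈ F₀) ∧
      (∀ x, Tendsto (fun n => u n x) atTop (𝓝 (f x))) ∧
      Tendsto (fun n => excessRisk ℓ P fs (u n)) atTop (𝓝 (excessRisk ℓ P fs f))

/-- `m` is a median of the real numbers `x 0, …, x (K - 1)`: at least half of them are `≤ m` and
at least half of them are `≥ m`. -/
def IsMedian {K : ℕ} (x : Fin K → ℝ) (m : ℝ) : Prop :=
  K ≤ 2 * (Finset.univ.filter fun k => x k ≤ m).card ∧
    K ≤ 2 * (Finset.univ.filter fun k => m ≤ x k).card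

/-- The empirical mean of `g` over the block `b` of the data set `z`. -/
def blockMean {N : ℕ} {S : Type*} (b : Finset (Fin N)) (z : Fin N → S) (g : S → ℝ) : ℝ :=
  (∑ i ∈ b, g (z i)) / (b.card : ℝ)

/-- The median-of-means estimator `MOM_K(g)` for the blocks `B 0, …, B (K - 1)`; `med` is the rule
by which a median is selected. -/
def mom {N K : ℕ} {S : Type*} (med : (Fin K → ℝ) → ℝ) (B : Fin K → Finset (Fin N))
    (z : Fin N → S) (g : S → ℝ) : ℝ :=
  med fun k => blockMean (B k) z g

/-- The criterion `sup_{g ∈ F} MOM_K(ℓ_f - ℓ_g)`, with values in the extended reals. -/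
def criterion {N K : ℕ} {𝒳 𝒴 : Type*} (med : (Fin K → ℝ) → ℝ) (B : Fin K → Finset (Fin N))
    (ℓ : ℝ → 𝒴 → ℝ) (F : Set (𝒳 → ℝ)) (z : Fin N → 𝒳 × 𝒴) (f : 𝒳 → ℝ) : EReal :=
  ⨆ g ∈ F, ((mom med B z (lossDiff ℓ f g) : ℝ) : EReal)

/-- `f ∈ argmin_{f ∈ F} sup_{g ∈ F} MOM_K(ℓ_f - ℓ_g)` for the data set `z`. -/
def IsMinmaxMOM {N K : ℕ} {𝒳 𝒴 : Type*} (med : (Fin K → ℝ) → ℝ) (B : Fin K → Finset (Fin N))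
    (ℓ : ℝ → 𝒴 → ℝ) (F : Set (𝒳 → ℝ)) (z : Fin N → 𝒳 × 𝒴) (f : 𝒳 → ℝ) : Prop :=
  f ∈ F ∧ ∀ h ∈ F, criterion med B ℓ F z f ≤ criterion med B ℓ F z h

/-- The localized class `{f ∈ F : P (ℓ_f - ℓ_{fs}) ≤ r²}`. -/
def localClass {𝒳 𝒴 : Type*} [MeasurableSpace 𝒳] [MeasurableSpace 𝒴]
    (ℓ : ℝ → 𝒴 → ℝ) (P : Measure (𝒳 × 𝒴)) (F : Set (𝒳 → ℝ)) (fs : 𝒳 → ℝ) (r : ℝ) :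
    Set (𝒳 → ℝ) :=
  {f | f ∈ F ∧ excessRisk ℓ P fs f ≤ r ^ 2}

/-- The Rademacher complexity `E(r)` of the localized class, for a sample of size `n` with inliers
`I`. The expectation over the i.i.d. signs, which are independent of the data, is the average over
all sign vectors `σ`. -/
def rademacherTerm {Ω 𝒳 𝒴 : Type*} [MeasurableSpace Ω] [MeasurableSpace 𝒳] [MeasurableSpace 𝒴]
    {N : ℕ} (ℓ : ℝ → 𝒴 → ℝ) (P : Measure (𝒳 × 𝒴)) (F : Set (𝒳 → ℝ)) (fs : 𝒳 → ℝ)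
    (Pr : Measure Ω) (Z : Fin N → Ω → 𝒳 × 𝒴) (I : Finset (Fin N)) (n : ℕ) (r : ℝ) : ℝ≥0∞ :=
  ⨆ (J : Finset (Fin N)) (_ : J ⊆ I) (_ : (n : ℝ) / 2 ≤ J.card),
    ∫⁻ ω, (∑ σ : Fin N → ℤˣ, ⨆ f ∈ localClass ℓ P F fs r,
      ENNReal.ofReal |(1 / (J.card : ℝ)) *
        ∑ i ∈ J, ((σ i : ℤ) : ℝ) * (f (Z i ω).1 - fs (Z i ω).1)|) / 2 ^ N ∂Pr

/-- The variance term `V_K(r)` of the localized class, for a sample of size `n` with inliers `I`;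
`Pr.map (Z i)` is the law of the `i`-th observation. -/
def varianceTerm {Ω 𝒳 𝒴 : Type*} [MeasurableSpace Ω] [MeasurableSpace 𝒳] [MeasurableSpace 𝒴]
    {N : ℕ} (ℓ : ℝ → 𝒴 → ℝ) (P : Measure (𝒳 × 𝒴)) (F : Set (𝒳 → ℝ)) (fs : 𝒳 → ℝ)
    (Pr : Measure Ω) (Z : Fin N → Ω → 𝒳 × 𝒴) (I : Finset (Fin N)) (n K : ℕ) (r : ℝ) : ℝ≥0∞ :=
  ⨆ i ∈ I, ⨆ f ∈ localClass ℓ P F fs r,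
    ENNReal.ofReal (√(variance (lossDiff ℓ f fs) (Pr.map (Z i))) * √((K : ℝ) / n))

/-- The infimum of the `r > 0` with `max (E(r) / γ) (√1536 V_K(r)) ≤ r²`. It is `∞` if there is no
such `r`. -/
def complexityInf {Ω 𝒳 𝒴 : Type*} [MeasurableSpace Ω] [MeasurableSpace 𝒳] [MeasurableSpace 𝒴]
    {N : ℕ} (ℓ : ℝ → 𝒴 → ℝ) (P : Measure (𝒳 × 𝒴)) (F : Set (𝒳 → ℝ)) (fs : 𝒳 → ℝ)
    (Pr : Measure Ω) (Z : Fin N → Ω → 𝒳 × 𝒴) (I : Finset (Fin N)) (n K : ℕ) (γ : ℝ) : ℝ≥0∞ :=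
  ⨅ (r : ℝ) (_ : 0 < r)
    (_ : max (rademacherTerm ℓ P F fs Pr Z I n r / ENNReal.ofReal γ)
      (ENNReal.ofReal √1536 * varianceTerm ℓ P F fs Pr Z I n K r) ≤ ENNReal.ofReal (r ^ 2)),
    ENNReal.ofReal r

end MinmaxMOM

end

/-! Fix `r` satisfying the complexity condition. The core is an event on which, for every `f` with
excess risk at most `r²`, more than half of all block means of `ℓ_f - ℓ_{fs}` lie within `r² / 4` of
the excess risk (`MostBlocksGood`).

On that event the conclusion is deterministic (`excessRisk_le_of_mostBlocksGood`). If `f` has risk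
above `r²`, the segment from `fs` to `f` contains a point of risk exactly `r²`. Most of its block
means are at least `3 r² / 4`, and by convexity of the loss so are those of `f`. Hence the criterion
is at least `3 r² / 4` at such an `f`, while at `fs` it is at most `r² / 4`: no minimizer has risk
above `r²`.

For the event (`measure_many_bad_blocks_le`), at least `m ≥ 4K/7` blocks contain no outlier. Among
these, the number of bad blocks is dominated by a sum of Lipschitz ramps. Its expectation for fixed
`f` is at most `m/96` by Chebyshev. The expected supremum of the centered sum is at most `m/24`, by
symmetrization over blocks, contraction of the ramp, symmetrization over observations and
contraction of the loss. McDiarmid adds another `m/24`, with failure probability `exp (-m/1152) ≤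
exp (-K/2016)`. In total fewer than `3m/32` clean blocks are bad, and `(29/32) (4/7) > 1/2`.

Suprema are taken over a countable subclass, then extended by approximation
(`mostBlocksGood_of_countable`). The infimum defining the radius need not be attained, so radii
tending to it are used and their events are combined by a limsup. -/

namespace MinmaxMOM

/-! ### Contraction principle for averages over sign vectors. -/

section Contraction

/-- The one-coordinate case: `a s - a t ≤ |b s - b t|`, and the sign of `b s - b t` decides which of
`s`, `t` goes to which supremum on the right. Truncation at zero is additive only on nonnegative
terms; a negative term is replaced by the one at `t₀`, where everything vanishes. -/
theorem iSup_ofReal_add_iSup_ofReal_sub_le {T : Type*} (A a b : T → ℝ) (t₀ : T)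
    (hA : A t₀ = 0) (ha : a t₀ = 0) (h : ∀ s t, |a s - a t| ≤ |b s - b t|) :
    (⨆ t, ENNReal.ofReal (A t + a t)) + (⨆ t, ENNReal.ofReal (A t - a t)) ≤
      (⨆ t, ENNReal.ofReal (A t + b t)) + ⨆ t, ENNReal.ofReal (A t - b t) := by
  have key : ∀ s t, 0 ≤ A s + a s → 0 ≤ A t - a t →
      ENNReal.ofReal (A s + a s) + ENNReal.ofReal (A t - a t) ≤
      (⨆ t, ENNReal.ofReal (A t + b t)) + ⨆ t, ENNReal.ofReal (A t - b t) := by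
    intro s t hs ht
    rw [← ENNReal.ofReal_add hs ht]
    have h1 := (le_abs_self _).trans (h s t)
    rcases abs_cases (b s - b t) with ⟨h2, -⟩ | ⟨h2, -⟩
    · calc ENNReal.ofReal (A s + a s + (A t - a t))
          ≤ ENNReal.ofReal ((A s + b s) + (A t - b t)) := ENNReal.ofReal_le_ofReal (by linarith)
        _ ≤ _ := ENNReal.ofReal_add_le
        _ ≤ _ := add_le_add (le_iSup (fun t => ENNReal.ofReal (A t + b t)) s)
            (le_iSup (fun t => ENNReal.ofReal (A t - b t)) t)
    · calc ENNReal.ofReal (A s + a s + (A t - a t))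
          ≤ ENNReal.ofReal ((A t + b t) + (A s - b s)) := ENNReal.ofReal_le_ofReal (by linarith)
        _ ≤ _ := ENNReal.ofReal_add_le
        _ ≤ _ := add_le_add (le_iSup (fun t => ENNReal.ofReal (A t + b t)) t)
            (le_iSup (fun t => ENNReal.ofReal (A t - b t)) s)
  have : Nonempty T := ⟨t₀⟩
  refine ENNReal.iSup_add_iSup_le fun s t => ?_
  have hp : ∃ s', 0 ≤ A s' + a s' ∧ ENNReal.ofReal (A s + a s) ≤ ENNReal.ofReal (A s' + a s') := by
    rcases le_total 0 (A s + a s) with hs | hs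
    · exact ⟨s, hs, le_rfl⟩
    · exact ⟨t₀, by simp [hA, ha], by simp [ENNReal.ofReal_of_nonpos hs]⟩
  have hq : ∃ t', 0 ≤ A t' - a t' ∧ ENNReal.ofReal (A t - a t) ≤ ENNReal.ofReal (A t' - a t') := by
    rcases le_total 0 (A t - a t) with hs | hs
    · exact ⟨t, hs, le_rfl⟩
    · exact ⟨t₀, by simp [hA, ha], by simp [ENNReal.ofReal_of_nonpos hs]⟩
  obtain ⟨s', hs', hs⟩ := hp
  obtain ⟨t', ht', ht⟩ := hq
  exact (add_le_add hs ht).trans (key s' t' hs' ht')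

theorem sum_flip_sign {ι M : Type*} [Fintype ι] [DecidableEq ι] [AddCommMonoid M]
    (i : ι) (H : (ι → ℤˣ) → M) :
    ∑ σ, H (Function.update σ i (-σ i)) = ∑ σ, H σ := by
  have hinv : Function.Involutive fun σ : ι → ℤˣ => Function.update σ i (-σ i) := by
    intro σ; simp
  exact Equiv.sum_comp hinv.toPerm H

/-- Pairing each sign vector with its flip at `i` doubles both sums and reduces the claim to the
two-supremum inequality, the other coordinates forming the common part `A`. -/
theorem sum_signs_contraction_step {ι T : Type*} [Fintype ι] [DecidableEq ι] (w w' : T → ι → ℝ)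
    (t₀ : T) (hw : w t₀ = 0) (i : ι) (hne : ∀ t, ∀ j ≠ i, w t j = w' t j)
    (h : ∀ s t, |w s i - w t i| ≤ |w' s i - w' t i|) :
    ∑ σ : ι → ℤˣ, ⨆ t, ENNReal.ofReal (∑ j, ((σ j : ℤ) : ℝ) * w t j) ≤
      ∑ σ : ι → ℤˣ, ⨆ t, ENNReal.ofReal (∑ j, ((σ j : ℤ) : ℝ) * w' t j) := by
  have split : ∀ (x : T → ι → ℝ) (σ : ι → ℤˣ) (t : T), ∑ j, ((σ j : ℤ) : ℝ) * x t j =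
      (∑ j ∈ Finset.univ.erase i, ((σ j : ℤ) : ℝ) * x t j) + ((σ i : ℤ) : ℝ) * x t i := by
    intro x σ t
    rw [Finset.sum_erase_add _ _ (Finset.mem_univ i)]
  have split' : ∀ (x : T → ι → ℝ) (σ : ι → ℤˣ) (t : T),
      ∑ j, ((Function.update σ i (-σ i) j : ℤ) : ℝ) * x t j =
      (∑ j ∈ Finset.univ.erase i, ((σ j : ℤ) : ℝ) * x t j) - ((σ i : ℤ) : ℝ) * x t i := by
    intro x σ t
    rw [split, sub_eq_add_neg]
    congr 1
    · refine Finset.sum_congr rfl fun j hj => ?_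
      rw [Function.update_of_ne (Finset.ne_of_mem_erase hj)]
    · simp
  have pair : ∀ x : T → ι → ℝ,
      (∑ σ : ι → ℤˣ, ((⨆ t, ENNReal.ofReal (∑ j, ((σ j : ℤ) : ℝ) * x t j)) +
        ⨆ t, ENNReal.ofReal (∑ j, ((Function.update σ i (-σ i) j : ℤ) : ℝ) * x t j))) =
      2 * ∑ σ : ι → ℤˣ, ⨆ t, ENNReal.ofReal (∑ j, ((σ j : ℤ) : ℝ) * x t j) := by
    intro x
    rw [Finset.sum_add_distrib, two_mul,
      sum_flip_sign i fun σ => ⨆ t, ENNReal.ofReal (∑ j, ((σ j : ℤ) : ℝ) * x t j)]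
  have main : 2 * ∑ σ : ι → ℤˣ, (⨆ t, ENNReal.ofReal (∑ j, ((σ j : ℤ) : ℝ) * w t j)) ≤
      2 * ∑ σ : ι → ℤˣ, ⨆ t, ENNReal.ofReal (∑ j, ((σ j : ℤ) : ℝ) * w' t j) := by
    rw [← pair w, ← pair w']
    refine Finset.sum_le_sum fun σ _ => ?_
    simp_rw [split', split]
    have hA : ∀ t, ∑ j ∈ Finset.univ.erase i, ((σ j : ℤ) : ℝ) * w' t j =
        ∑ j ∈ Finset.univ.erase i, ((σ j : ℤ) : ℝ) * w t j := fun t =>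
      Finset.sum_congr rfl fun j hj => by rw [hne t j (Finset.ne_of_mem_erase hj)]
    simp_rw [hA]
    refine iSup_ofReal_add_iSup_ofReal_sub_le _ (fun t => ((σ i : ℤ) : ℝ) * w t i)
      (fun t => ((σ i : ℤ) : ℝ) * w' t i) t₀ (by simp [hw]) (by simp [hw]) fun s t => ?_
    rw [← mul_sub, ← mul_sub, abs_mul, abs_mul]
    exact mul_le_mul_of_nonneg_left (h s t) (abs_nonneg _)
  exact (ENNReal.mul_le_mul_iff_right (by simp) (by simp)).1 main

/-- The contraction principle for Rademacher averages, for positive parts. -/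
theorem sum_signs_contraction {ι T : Type*} [Fintype ι] [DecidableEq ι] (u v : T → ι → ℝ)
    (t₀ : T) (hu : u t₀ = 0) (hv : v t₀ = 0)
    (h : ∀ i s t, |u s i - u t i| ≤ |v s i - v t i|) :
    ∑ σ : ι → ℤˣ, ⨆ t, ENNReal.ofReal (∑ j, ((σ j : ℤ) : ℝ) * u t j) ≤
      ∑ σ : ι → ℤˣ, ⨆ t, ENNReal.ofReal (∑ j, ((σ j : ℤ) : ℝ) * v t j) := by
  -- Interpolation: `v` is replaced by `u` one coordinate at a time.
  have key : ∀ s : Finset ι,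
      ∑ σ : ι → ℤˣ, ⨆ t, ENNReal.ofReal (∑ j, ((σ j : ℤ) : ℝ) * (if j ∈ s then u t j else v t j)) ≤
      ∑ σ : ι → ℤˣ, ⨆ t, ENNReal.ofReal (∑ j, ((σ j : ℤ) : ℝ) * v t j) := by
    intro s
    induction s using Finset.induction_on with
    | empty => simp
    | insert i s hi ih =>
      refine le_trans ?_ ih
      refine sum_signs_contraction_step (fun t j => if j ∈ insert i s then u t j else v t j)
        (fun t j => if j ∈ s then u t j else v t j) t₀ ?_ i ?_ ?_
      · ext j; simp [hu, hv]
      · intro t j hj; simp [hj]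
      · intro a b; simpa [hi] using h i a b
  simpa using key Finset.univ

/-- Each sign vector on the subtype has `2 ^ card {i // ¬ p i}` extensions, so averaging over the
unused signs changes nothing. -/
theorem sum_signs_restrict {ι : Type*} [Fintype ι] [DecidableEq ι] (p : ι → Prop)
    [DecidablePred p] (H : ({i // p i} → ℤˣ) → ℝ≥0∞) :
    (∑ τ, H τ) / 2 ^ Fintype.card {i // p i} =
      (∑ σ : ι → ℤˣ, H fun i => σ i) / 2 ^ Fintype.card ι := by
  have h1 : ∑ σ : ι → ℤˣ, H (fun i => σ i) =
      2 ^ Fintype.card {i // ¬ p i} * ∑ τ, H τ := by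
    rw [← Equiv.sum_comp (Equiv.piEquivPiSubtypeProd p fun _ : ι => ℤˣ).symm]
    rw [Fintype.sum_prod_type, Finset.mul_sum]
    refine Finset.sum_congr rfl fun τ _ => ?_
    rw [Finset.sum_congr rfl (g := fun _ => H τ)]
    · simp [Finset.card_univ]
    · intro x _
      congr 1
      ext i
      simp [Equiv.piEquivPiSubtypeProd, i.2]
  have h2 : Fintype.card ι = Fintype.card {i // ¬ p i} + Fintype.card {i // p i} := by
    rw [add_comm, Fintype.card_subtype_compl]
    have := Fintype.card_subtype_le p
    omega
  rw [h1, h2, pow_add, ENNReal.mul_div_mul_left _ _ (by simp) (by simp)]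

end Contraction

end MinmaxMOM

/-! ### Symmetrization with a ghost sample. -/

namespace MinmaxMOM

section Symmetrization

theorem ofReal_integral_le_lintegral_ofReal {α : Type*} [MeasurableSpace α] {μ : Measure α}
    {f : α → ℝ} (hf : Integrable f μ) :
    ENNReal.ofReal (∫ x, f x ∂μ) ≤ ∫⁻ x, ENNReal.ofReal (f x) ∂μ := by
  rw [integral_eq_lintegral_pos_part_sub_lintegral_neg_part hf]
  exact (ENNReal.ofReal_le_ofReal (sub_le_self _ ENNReal.toReal_nonneg)).trans
    ENNReal.ofReal_toReal_le

variable {κ S T : Type*} [Fintype κ] [Countable T] [MeasurableSpace S]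

/-- Exchanging the two copies in the coordinates where `σ k = -1` preserves the product law and
flips exactly those differences. -/
theorem lintegral_swap_signs (ν : κ → Measure S) [∀ k, IsProbabilityMeasure (ν k)]
    (h : T → κ → S → ℝ) (hm : ∀ t k, Measurable (h t k)) (σ : κ → ℤˣ) :
    ∫⁻ p, ⨆ t, ENNReal.ofReal (∑ k, (h t k (p.1 k) - h t k (p.2 k)))
        ∂((Measure.pi ν).prod (Measure.pi ν)) =
      ∫⁻ p, ⨆ t, ENNReal.ofReal (∑ k, ((σ k : ℤ) : ℝ) * (h t k (p.1 k) - h t k (p.2 k)))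
        ∂((Measure.pi ν).prod (Measure.pi ν)) := by
  have he := measurePreserving_arrowProdEquivProdArrow S S κ ν ν
  rw [← he.map_eq, lintegral_map_equiv, lintegral_map_equiv]
  let f : κ → S × S → S × S := fun k => if σ k = 1 then id else Prod.swap
  have hf : MeasurePreserving (fun (a : κ → S × S) k => f k (a k))
      (Measure.pi fun k => (ν k).prod (ν k)) (Measure.pi fun k => (ν k).prod (ν k)) := by
    refine measurePreserving_pi _ _ fun k => ?_
    by_cases hk : σ k = 1
    · simp only [f, hk, if_true]; exact MeasurePreserving.id _
    · simp only [f, hk, if_false]; exact Measure.measurePreserving_swap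
  rw [← hf.lintegral_comp]
  · refine lintegral_congr fun a => iSup_congr fun t => ?_
    congr 1
    refine Finset.sum_congr rfl fun k _ => ?_
    rcases Int.units_eq_one_or (σ k) with hk | hk
    · simp [MeasurableEquiv.arrowProdEquivProdArrow, f, hk]
    · have : (-1 : ℤˣ) ≠ 1 := by decide
      simp [MeasurableEquiv.arrowProdEquivProdArrow, f, hk, this]
  · refine Measurable.iSup fun t => ENNReal.measurable_ofReal.comp ?_
    refine Finset.measurable_fun_sum _ fun k _ => ?_
    have h1 := hm t k
    simp only [MeasurableEquiv.arrowProdEquivProdArrow, MeasurableEquiv.coe_mk,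
      Equiv.arrowProdEquivProdArrow_apply]
    fun_prop

theorem lintegral_symmetrization_pi [DecidableEq κ] (ν : κ → Measure S)
    [∀ k, IsProbabilityMeasure (ν k)]
    (h : T → κ → S → ℝ) (hm : ∀ t k, Measurable (h t k))
    (hi : ∀ t k, Integrable (h t k) (ν k)) :
    ∫⁻ w, ⨆ t, ENNReal.ofReal (∑ k, (h t k (w k) - ∫ x, h t k x ∂ν k)) ∂(Measure.pi ν) ≤
      2 * ((∫⁻ w, ∑ σ : κ → ℤˣ, ⨆ t, ENNReal.ofReal (∑ k, ((σ k : ℤ) : ℝ) * h t k (w k))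
        ∂(Measure.pi ν)) / 2 ^ Fintype.card κ) := by
  set π := Measure.pi ν with hπ
  have hint : ∀ t k, Integrable (fun w : κ → S => h t k (w k)) π := fun t k =>
    (measurePreserving_eval ν k).integrable_comp_of_integrable (hi t k)
  have hintv : ∀ t k, ∫ w : κ → S, h t k (w k) ∂π = ∫ x, h t k x ∂ν k := fun t k => by
    have := (measurePreserving_eval ν k).map_eq
    rw [← this, integral_map (measurable_pi_apply k).aemeasurable
      (hm t k).aestronglyMeasurable]
  have hmD : ∀ σ : κ → ℤˣ, Measurable fun p : (κ → S) × (κ → S) => ⨆ t, ENNReal.ofReal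
      (∑ k, ((σ k : ℤ) : ℝ) * (h t k (p.1 k) - h t k (p.2 k))) := fun σ => by fun_prop
  have hmU : ∀ σ : κ → ℤˣ, Measurable fun w : κ → S => ⨆ t, ENNReal.ofReal
      (∑ k, ((σ k : ℤ) : ℝ) * h t k (w k)) := fun σ => by fun_prop
  have step1 : ∫⁻ w, ⨆ t, ENNReal.ofReal (∑ k, (h t k (w k) - ∫ x, h t k x ∂ν k)) ∂π ≤
      ∫⁻ p, ⨆ t, ENNReal.ofReal (∑ k, (h t k (p.1 k) - h t k (p.2 k))) ∂(π.prod π) := by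
    rw [lintegral_prod _ (by simpa using (hmD 1).aemeasurable)]
    refine lintegral_mono fun w => iSup_le fun t => ?_
    have hI : Integrable (fun w' : κ → S => ∑ k, (h t k (w k) - h t k (w' k))) π :=
      integrable_finsetSum _ fun k _ => (integrable_const _).sub (hint t k)
    have : ∑ k, (h t k (w k) - ∫ x, h t k x ∂ν k) =
        ∫ w', ∑ k, (h t k (w k) - h t k (w' k)) ∂π := by
      rw [integral_finsetSum Finset.univ (f := fun k (w' : κ → S) => h t k (w k) - h t k (w' k))
        fun k _ => (integrable_const _).sub (hint t k)]
      refine Finset.sum_congr rfl fun k _ => ?_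
      rw [integral_sub (integrable_const _) (hint t k), hintv]
      simp
    rw [this]
    refine (ofReal_integral_le_lintegral_ofReal hI).trans (lintegral_mono fun w' => ?_)
    exact le_iSup (fun t => ENNReal.ofReal (∑ k, (h t k (w k) - h t k (w' k)))) t
  -- The bound holds for each fixed `σ`, with `σ` on one copy and `-σ` on the other. Summing over
  -- `σ` identifies the two halves, whence the factor 2.
  have step2 : ∀ σ : κ → ℤˣ,
      ∫⁻ p, ⨆ t, ENNReal.ofReal (∑ k, (h t k (p.1 k) - h t k (p.2 k))) ∂(π.prod π) ≤
      (∫⁻ w, ⨆ t, ENNReal.ofReal (∑ k, ((σ k : ℤ) : ℝ) * h t k (w k)) ∂π) +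
      ∫⁻ w, ⨆ t, ENNReal.ofReal (∑ k, (((-σ) k : ℤ) : ℝ) * h t k (w k)) ∂π := by
    intro σ
    rw [lintegral_swap_signs ν h hm σ]
    calc _ ≤ ∫⁻ p : (κ → S) × (κ → S),
          ((⨆ t, ENNReal.ofReal (∑ k, ((σ k : ℤ) : ℝ) * h t k (p.1 k))) +
          ⨆ t, ENNReal.ofReal (∑ k, (((-σ) k : ℤ) : ℝ) * h t k (p.2 k))) ∂(π.prod π) := by
          refine lintegral_mono fun p => iSup_le fun t => ?_
          refine le_trans (le_trans (ENNReal.ofReal_le_ofReal (le_of_eq ?_))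
            ENNReal.ofReal_add_le) (add_le_add
              (le_iSup (fun t => ENNReal.ofReal (∑ k, ((σ k : ℤ) : ℝ) * h t k (p.1 k))) t)
              (le_iSup (fun t => ENNReal.ofReal (∑ k, (((-σ) k : ℤ) : ℝ) * h t k (p.2 k))) t))
          rw [← Finset.sum_add_distrib]
          refine Finset.sum_congr rfl fun k _ => ?_
          simp only [Pi.neg_apply, Units.val_neg, Int.cast_neg]
          ring
      _ = _ := by
          rw [lintegral_add_left (f := fun p : (κ → S) × (κ → S) =>
            ⨆ t, ENNReal.ofReal (∑ k, ((σ k : ℤ) : ℝ) * h t k (p.1 k)))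
            ((hmU σ).comp measurable_fst)]
          congr 1
          · exact (measurePreserving_fst (μ := π) (ν := π)).lintegral_comp (hmU σ)
          · exact (measurePreserving_snd (μ := π) (ν := π)).lintegral_comp (hmU (-σ))
  have step3 := Finset.sum_le_sum fun σ (_ : σ ∈ (Finset.univ : Finset (κ → ℤˣ))) => step2 σ
  have hneg := Equiv.sum_comp (Equiv.neg (κ → ℤˣ)) fun σ =>
    ∫⁻ w, ⨆ t, ENNReal.ofReal (∑ k, ((σ k : ℤ) : ℝ) * h t k (w k)) ∂π
  simp only [Equiv.neg_apply] at hneg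
  rw [Finset.sum_add_distrib, hneg, ← two_mul,
    ← lintegral_finsetSum _ fun σ _ => hmU σ, Finset.sum_const, Finset.card_univ] at step3
  refine step1.trans ?_
  rw [← mul_div_assoc, ENNReal.le_div_iff_mul_le (by simp) (by simp), mul_comm]
  simpa using step3

theorem lintegral_symmetrization [DecidableEq κ] {Ω : Type*} [MeasurableSpace Ω] {Pr : Measure Ω}
    [IsProbabilityMeasure Pr] (W : κ → Ω → S) (hW : ∀ k, Measurable (W k))
    (hind : iIndepFun W Pr)
    (h : T → κ → S → ℝ) (hm : ∀ t k, Measurable (h t k))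
    (hi : ∀ t k, Integrable (fun ω => h t k (W k ω)) Pr) :
    ∫⁻ ω, ⨆ t, ENNReal.ofReal (∑ k, (h t k (W k ω) - ∫ ω', h t k (W k ω') ∂Pr)) ∂Pr ≤
      2 * ((∫⁻ ω, ∑ σ : κ → ℤˣ, ⨆ t, ENNReal.ofReal (∑ k, ((σ k : ℤ) : ℝ) * h t k (W k ω))
        ∂Pr) / 2 ^ Fintype.card κ) := by
  have hprob : ∀ k, IsProbabilityMeasure (Pr.map (W k)) := fun k =>
    Measure.isProbabilityMeasure_map (hW k).aemeasurable
  have hmap := (iIndepFun_iff_map_fun_eq_pi_map fun k => (hW k).aemeasurable).1 hind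
  have hWm : Measurable fun ω k => W k ω := measurable_pi_lambda _ hW
  have key := lintegral_symmetrization_pi (fun k => Pr.map (W k)) h hm fun t k =>
    (integrable_map_measure (hm t k).aestronglyMeasurable (hW k).aemeasurable).2 (hi t k)
  rw [← hmap, lintegral_map (by fun_prop) hWm, lintegral_map (by fun_prop) hWm] at key
  have hE : ∀ t k, ∫ x, h t k x ∂(Pr.map (W k)) = ∫ ω', h t k (W k ω') ∂Pr := fun t k =>
    integral_map (hW k).aemeasurable (hm t k).aestronglyMeasurable
  simpa only [hE] using key

end Symmetrization

end MinmaxMOM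

/-! ### Bounded differences inequality and independence of blocks. -/

namespace MinmaxMOM

section BoundedDifferences

/-- The bounded differences inequality, in exponential form, on a product space. -/
theorem hasSubgaussianMGF_of_bounded_differences_pi {S : Type*} [MeasurableSpace S] (m : ℕ)
    (ν : Fin m → Measure S) [∀ k, IsProbabilityMeasure (ν k)] (g : (Fin m → S) → ℝ)
    (hg : Measurable g) (hd : ∀ w k x, |g (Function.update w k x) - g w| ≤ 1) (C : ℝ)
    (hC : ∀ w, |g w| ≤ C) :
    HasSubgaussianMGF (fun w => g w - ∫ w', g w' ∂(Measure.pi ν)) m (Measure.pi ν) := by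
  induction m generalizing C with
  | zero =>
    have : ∀ w, g w = g default := fun w => by rw [Subsingleton.elim w default]
    simp [this]
  | succ m ih =>
    set π := Measure.pi ν
    set π' := Measure.pi fun k : Fin m => ν (Fin.succAbove 0 k)
    let e := MeasurableEquiv.piFinSuccAbove (fun _ : Fin (m + 1) => S) 0
    have he : MeasurePreserving e π ((ν 0).prod π') := measurePreserving_piFinSuccAbove ν 0
    let G : S → (Fin m → S) → ℝ := fun x w => g (Fin.cons x w)
    have hes : ∀ p, e.symm p = Fin.cons p.1 p.2 := fun p => by
      simp [e, MeasurableEquiv.piFinSuccAbove]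
      rfl
    have hGe : ∀ w, g w = G (e w).1 (e w).2 := fun w => by
      have := hes (e w)
      simp only [MeasurableEquiv.symm_apply_apply] at this
      simp only [G]; rw [← this]
    have hGm : Measurable fun p : S × (Fin m → S) => G p.1 p.2 := by
      have : (fun p : S × (Fin m → S) => G p.1 p.2) = g ∘ e.symm := by
        ext p; simp [G, hes]
      rw [this]; exact hg.comp e.symm.measurable
    have hGm1 : ∀ w, Measurable fun x => G x w := fun w =>
      hGm.comp (measurable_id.prodMk measurable_const)
    have hG1 : ∀ x y w, |G x w - G y w| ≤ 1 := fun x y w => by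
      simpa [G, Fin.update_cons_zero] using hd (Fin.cons y w) 0 x
    have hG2 : ∀ x w k y, |G x (Function.update w k y) - G x w| ≤ 1 := fun x w k y => by
      simpa [G, Fin.cons_update] using hd (Fin.cons x w) k.succ y
    have hGC : ∀ x w, |G x w| ≤ C := fun x w => hC _
    have hGi : ∀ w, Integrable (fun x => G x w) (ν 0) := fun w =>
      Integrable.of_bound (hGm1 w).aestronglyMeasurable C (ae_of_all _ fun x => hGC x w)
    -- Integrating out the first coordinate preserves the bounded differences, so the induction
    -- hypothesis applies to `A`; the remainder `G x w - A w` is handled by Hoeffding's lemma at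
    -- fixed `w`.
    let A : (Fin m → S) → ℝ := fun w => ∫ x, G x w ∂ν 0
    have hAm : Measurable A := by
      have : StronglyMeasurable fun p : (Fin m → S) × S => G p.2 p.1 :=
        (hGm.comp measurable_swap).stronglyMeasurable
      exact this.integral_prod_right'.measurable
    have hAC : ∀ w, |A w| ≤ C := fun w => by
      have := norm_integral_le_of_norm_le_const (μ := ν 0) (f := fun x => G x w) (C := C)
        (ae_of_all _ fun x => hGC x w)
      simpa using this
    have hAd : ∀ w k y, |A (Function.update w k y) - A w| ≤ 1 := fun w k y => by
      simp only [A]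
      rw [← integral_sub (hGi _) (hGi _)]
      have := norm_integral_le_of_norm_le_const (μ := ν 0) (C := 1)
        (f := fun x => G x (Function.update w k y) - G x w) (ae_of_all _ fun x => hG2 x w k y)
      simpa using this
    have hmean : ∫ w, g w ∂π = ∫ w, A w ∂π' := by
      have hI : Integrable (fun p : S × (Fin m → S) => G p.1 p.2) ((ν 0).prod π') :=
        Integrable.of_bound hGm.aestronglyMeasurable C (ae_of_all _ fun p => hGC _ _)
      simp_rw [hGe]
      rw [he.integral_comp' (g := fun p : S × (Fin m → S) => G p.1 p.2),
        integral_prod_symm _ hI]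
    have hIH := ih (fun k => ν (Fin.succAbove 0 k)) A hAm hAd C hAC
    rw [hmean]
    set a := ∫ w, A w ∂π' with ha
    have haC : |a| ≤ C := by
      have := norm_integral_le_of_norm_le_const (μ := π') (f := A) (C := C)
        (ae_of_all _ fun x => hAC x)
      simpa using this
    have hbd : ∀ t x w, Real.exp (t * (G x w - a)) ≤ Real.exp (|t| * (2 * C)) := fun t x w => by
      refine Real.exp_le_exp.2 ((le_abs_self _).trans ?_)
      rw [abs_mul]
      refine mul_le_mul_of_nonneg_left ((abs_sub _ _).trans ?_) (abs_nonneg _)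
      linarith [hGC x w]
    have hEm : ∀ t, Measurable fun p : S × (Fin m → S) => Real.exp (t * (G p.1 p.2 - a)) :=
      fun t => by fun_prop
    have hEi : ∀ t, Integrable (fun p : S × (Fin m → S) => Real.exp (t * (G p.1 p.2 - a)))
        ((ν 0).prod π') := fun t =>
      Integrable.of_bound (hEm t).aestronglyMeasurable (Real.exp (|t| * (2 * C)))
        (ae_of_all _ fun p => by
          rw [Real.norm_of_nonneg (Real.exp_pos _).le]; exact hbd t _ _)
    refine ⟨fun t => ?_, fun t => ?_⟩
    · simp_rw [hGe]
      exact (he.integrable_comp_emb e.measurableEmbedding).2 (hEi t)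
    · unfold mgf
      simp_rw [hGe]
      rw [he.integral_comp' (g := fun p : S × (Fin m → S) => Real.exp (t * (G p.1 p.2 - a))),
        integral_prod_symm _ (hEi t)]
      have hinner : ∀ w, ∫ x, Real.exp (t * (G x w - a)) ∂ν 0 ≤
          Real.exp (t ^ 2 / 2) * Real.exp (t * (A w - a)) := fun w => by
        obtain ⟨x₀⟩ := (ν 0).nonempty_of_neZero
        -- Centering at an arbitrary `x₀` gives an interval of width 2, hence variance proxy 1 per
        -- coordinate. This is not sharp, but suffices for the constants.
        have hH := hasSubgaussianMGF_of_mem_Icc (μ := ν 0) (X := fun x => G x w)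
          (a := G x₀ w - 1) (b := G x₀ w + 1) (hGm1 w).aemeasurable
          (ae_of_all _ fun x => by
            have := abs_le.1 (hG1 x x₀ w)
            constructor <;> linarith)
        have h1 := hH.mgf_le t
        have h2 : G x₀ w + 1 - (G x₀ w - 1) = 2 := by ring
        rw [h2] at h1
        unfold mgf at h1
        have h3 : ∀ x, Real.exp (t * (G x w - a)) =
            Real.exp (t * (G x w - A w)) * Real.exp (t * (A w - a)) := fun x => by
          rw [← Real.exp_add]; congr 1; ring
        simp_rw [h3]
        rw [integral_mul_const]
        refine mul_le_mul_of_nonneg_right (h1.trans (le_of_eq ?_)) (Real.exp_pos _).le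
        norm_num
      have hI1 := hIH.integrable_exp_mul t
      calc ∫ w, ∫ x, Real.exp (t * (G x w - a)) ∂ν 0 ∂π'
          ≤ ∫ w, Real.exp (t ^ 2 / 2) * Real.exp (t * (A w - a)) ∂π' :=
            integral_mono (hEi t).integral_prod_right (hI1.const_mul _) hinner
        _ = Real.exp (t ^ 2 / 2) * mgf (fun w => A w - a) π' t := by
            rw [integral_const_mul]; rfl
        _ ≤ Real.exp (t ^ 2 / 2) * Real.exp ((m : NNReal) * t ^ 2 / 2) :=
            mul_le_mul_of_nonneg_left (hIH.mgf_le t) (Real.exp_pos _).le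
        _ = _ := by
            rw [← Real.exp_add]
            congr 1
            push_cast
            ring

/-- McDiarmid's bounded differences inequality. -/
theorem measure_bounded_differences_le {Ω S : Type*} [MeasurableSpace Ω] [MeasurableSpace S]
    {Pr : Measure Ω} [IsProbabilityMeasure Pr] {m : ℕ} (W : Fin m → Ω → S)
    (hW : ∀ k, Measurable (W k)) (hind : iIndepFun W Pr) (g : (Fin m → S) → ℝ)
    (hg : Measurable g) (hd : ∀ w k x, |g (Function.update w k x) - g w| ≤ 1) (C : ℝ)
    (hC : ∀ w, |g w| ≤ C) {ε : ℝ} (hε : 0 ≤ ε) :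
    Pr.real {ω | ε ≤ g (fun k => W k ω) - ∫ ω', g (fun k => W k ω') ∂Pr} ≤
      Real.exp (-ε ^ 2 / (2 * m)) := by
  have hprob : ∀ k, IsProbabilityMeasure (Pr.map (W k)) := fun k =>
    Measure.isProbabilityMeasure_map (hW k).aemeasurable
  have hWm : Measurable fun ω k => W k ω := measurable_pi_lambda _ hW
  have hmap := (iIndepFun_iff_map_fun_eq_pi_map fun k => (hW k).aemeasurable).1 hind
  have key := hasSubgaussianMGF_of_bounded_differences_pi m (fun k => Pr.map (W k)) g hg hd C hC
  rw [← hmap] at key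
  have h2 := (key.of_map hWm.aemeasurable).measure_ge_le hε
  rw [integral_map hWm.aemeasurable hg.aestronglyMeasurable] at h2
  simpa using h2

/-- The law of the array is a product over pairs; currying it yields the product of the row laws. -/
theorem iIndepFun_curry {Ω S ι κ : Type*} [Fintype ι] [Fintype κ] [MeasurableSpace Ω]
    [MeasurableSpace S] {Pr : Measure Ω} [IsProbabilityMeasure Pr] (Z : ι × κ → Ω → S)
    (hZ : ∀ p, Measurable (Z p)) (hind : iIndepFun Z Pr) :
    iIndepFun (fun i ω j => Z (i, j) ω) Pr := by
  have hprob : ∀ p, IsProbabilityMeasure (Pr.map (Z p)) := fun p =>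
    Measure.isProbabilityMeasure_map (hZ p).aemeasurable
  have hW : ∀ i, Measurable fun ω j => Z (i, j) ω := fun i =>
    measurable_pi_lambda _ fun j => hZ _
  have hrow : ∀ i, Pr.map (fun ω j => Z (i, j) ω) = Measure.pi fun j => Pr.map (Z (i, j)) :=
    fun i => (iIndepFun_iff_map_fun_eq_pi_map fun j => (hZ (i, j)).aemeasurable).1
      (hind.precomp (g := fun j => (i, j)) (Prod.mk_right_injective i))
  have hall := (iIndepFun_iff_map_fun_eq_pi_map fun p => (hZ p).aemeasurable).1 hind
  rw [iIndepFun_iff_map_fun_eq_pi_map fun i => (hW i).aemeasurable]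
  have hcurry := Measure.infinitePi_map_curry fun i j => Pr.map (Z (i, j))
  simp only [Measure.infinitePi_eq_pi, ← hrow] at hcurry
  have hprob' : ∀ i, IsProbabilityMeasure (Pr.map fun ω j => Z (i, j) ω) := fun i =>
    Measure.isProbabilityMeasure_map (hW i).aemeasurable
  rw [Measure.infinitePi_eq_pi] at hcurry
  rw [← hcurry]
  change _ = Measure.map _ (Measure.pi fun p => Pr.map (Z p))
  rw [← hall, Measure.map_map (MeasurableEquiv.measurable _) (measurable_pi_lambda _ hZ)]
  rfl

end BoundedDifferences

end MinmaxMOM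

/-! ### Probability that many outlier-free blocks are bad. -/

noncomputable section

namespace MinmaxMOM

section BadBlocks

/-- A Lipschitz majorant of the indicator of `{|x| ≥ 2}`, vanishing for `|x| ≤ 1`. -/
def ramp (x : ℝ) : ℝ := max 0 (min 1 (|x| - 1))

theorem ramp_nonneg (x : ℝ) : 0 ≤ ramp x := le_max_left _ _

theorem ramp_le_one (x : ℝ) : ramp x ≤ 1 := max_le zero_le_one (min_le_left _ _)

theorem ramp_zero : ramp 0 = 0 := by simp [ramp]

theorem ramp_eq_one {x : ℝ} (hx : 2 ≤ |x|) : ramp x = 1 := by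
  unfold ramp
  rw [min_eq_left (by linarith), max_eq_right zero_le_one]

theorem ramp_le_sq (x : ℝ) : ramp x ≤ x ^ 2 / 4 := by
  refine max_le (by positivity) ((min_le_right _ _).trans ?_)
  -- `|x| - 1 ≤ x² / 4` is `(|x| - 2)² ≥ 0`.
  nlinarith [sq_nonneg (|x| - 2), sq_abs x]

theorem measurable_ramp : Measurable ramp := by
  unfold ramp; fun_prop

theorem abs_ramp_sub_ramp_le (x y : ℝ) : |ramp x - ramp y| ≤ |x - y| := by
  unfold ramp
  have h1 := abs_max_sub_max_le_max 0 (min 1 (|x| - 1)) 0 (min 1 (|y| - 1))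
  have h2 := abs_min_sub_min_le_max 1 (|x| - 1) 1 (|y| - 1)
  simp only [sub_self, abs_zero, sub_sub_sub_cancel_right, abs_nonneg, sup_of_le_right] at h1 h2
  exact h1.trans (h2.trans (abs_abs_sub_abs_le x y))

theorem integral_sq_mean_sub_le {Ω : Type*} [MeasurableSpace Ω] {Pr : Measure Ω}
    [IsProbabilityMeasure Pr] {n : ℕ} (hn : 0 < n) (Y : Fin n → Ω → ℝ)
    (hY : ∀ j, MemLp (Y j) 2 Pr) (hind : iIndepFun Y Pr) (c v : ℝ)
    (hmean : ∀ j, ∫ ω, Y j ω ∂Pr = c) (hvar : ∀ j, variance (Y j) Pr ≤ n * v) :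
    Integrable (fun ω => ((∑ j, Y j ω) / n - c) ^ 2) Pr ∧
      ∫ ω, ((∑ j, Y j ω) / n - c) ^ 2 ∂Pr ≤ v := by
  have hn' : (0 : ℝ) < n := by exact_mod_cast hn
  have hsum : MemLp (∑ j, Y j) 2 Pr := memLp_finsetSum' _ fun j _ => hY j
  have hEsum : ∫ ω, (∑ j, Y j) ω ∂Pr = n * c := by
    simp only [Finset.sum_apply]
    rw [integral_finsetSum _ fun j _ => (hY j).integrable (by norm_num)]
    simp [hmean]
  have hv : variance (∑ j, Y j) Pr ≤ n * (n * v) := by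
    rw [IndepFun.variance_sum (fun j _ => hY j) fun i _ j _ hij => hind.indepFun hij]
    refine (Finset.sum_le_sum fun j _ => hvar j).trans ?_
    simp
  have heq : ∀ ω, ((∑ j, Y j ω) / n - c) ^ 2 = ((∑ j, Y j) ω - n * c) ^ 2 / n ^ 2 := fun ω => by
    rw [Finset.sum_apply, ← div_pow, sub_div, mul_div_cancel_left₀ _ hn'.ne']
  simp_rw [heq]
  refine ⟨((hsum.sub (memLp_const (n * c))).integrable_sq).div_const _, ?_⟩
  rw [integral_div]
  rw [variance_eq_integral hsum.aestronglyMeasurable.aemeasurable, hEsum] at hv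
  rw [div_le_iff₀ (by positivity)]
  calc _ ≤ _ := hv
    _ = _ := by ring

/-- This gives the bounded differences of a supremum; the common bound `M` keeps both suprema
finite, so that `toReal` loses nothing. -/
theorem abs_toReal_iSup_sub_le {T : Type*} {a b : T → ℝ} {M : ℝ} (ha : ∀ t, a t ≤ M)
    (hb : ∀ t, b t ≤ M) {d : ℝ} (hd : 0 ≤ d) (hab : ∀ t, |a t - b t| ≤ d) :
    |(⨆ t, ENNReal.ofReal (a t)).toReal - (⨆ t, ENNReal.ofReal (b t)).toReal| ≤ d := by
  have fin : ∀ {a : T → ℝ}, (∀ t, a t ≤ M) → (⨆ t, ENNReal.ofReal (a t)) ≠ ∞ := fun ha =>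
    ne_top_of_le_ne_top ENNReal.ofReal_ne_top
      (iSup_le fun t => ENNReal.ofReal_le_ofReal (ha t))
  have one : ∀ {a b : T → ℝ}, (∀ t, a t ≤ M) → (∀ t, b t ≤ M) → (∀ t, a t - b t ≤ d) →
      (⨆ t, ENNReal.ofReal (a t)).toReal ≤ (⨆ t, ENNReal.ofReal (b t)).toReal + d := by
    intro a b _ hb hab
    have : (⨆ t, ENNReal.ofReal (a t)) ≤ (⨆ t, ENNReal.ofReal (b t)) + ENNReal.ofReal d := by
      refine iSup_le fun t => ?_
      calc ENNReal.ofReal (a t) ≤ ENNReal.ofReal (b t + d) :=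
            ENNReal.ofReal_le_ofReal (by linarith [hab t])
        _ ≤ _ := ENNReal.ofReal_add_le
        _ ≤ _ := add_le_add_left (le_iSup (fun t => ENNReal.ofReal (b t)) t) _
    calc _ ≤ ((⨆ t, ENNReal.ofReal (b t)) + ENNReal.ofReal d).toReal :=
          ENNReal.toReal_mono (ENNReal.add_ne_top.2 ⟨fin hb, ENNReal.ofReal_ne_top⟩) this
      _ = _ := by rw [ENNReal.toReal_add (fin hb) ENNReal.ofReal_ne_top, ENNReal.toReal_ofReal hd]
  rw [abs_sub_le_iff]
  constructor
  · linarith [one ha hb fun t => (le_abs_self _).trans (hab t)]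
  · linarith [one hb ha fun t => (neg_sub (a t) (b t) ▸ neg_le_abs _ : b t - a t ≤ _).trans (hab t)]

variable {Ω S T : Type*} [MeasurableSpace Ω] [MeasurableSpace S] [Countable T]
  {Pr : Measure Ω} [IsProbabilityMeasure Pr]

/-- Symmetrization and contraction at the level of the observations. -/
theorem lintegral_signed_centered_le {ι : Type*} [Fintype ι] [DecidableEq ι]
    (Z : ι → Ω → S) (hZ : ∀ p, Measurable (Z p)) (hind : iIndepFun Z Pr)
    (h u : T → S → ℝ) (t₀ : T) (hm : ∀ t, Measurable (h t)) {L : ℝ} (hL : 0 ≤ L)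
    (hlip : ∀ s t z, |h s z - h t z| ≤ L * |u s z - u t z|) (hh₀ : h t₀ = 0) (hu₀ : u t₀ = 0)
    (hi : ∀ t p, Integrable (fun ω => h t (Z p ω)) Pr) {a : ℝ} (ha : 0 ≤ a)
    (s : ι → ℤˣ) :
    ∫⁻ ω, ⨆ t, ENNReal.ofReal (∑ p, ((s p : ℤ) : ℝ) *
        (a * (h t (Z p ω) - ∫ ω', h t (Z p ω') ∂Pr))) ∂Pr ≤
      2 * ENNReal.ofReal (a * L) * ((∫⁻ ω, ∑ σ : ι → ℤˣ, ⨆ t, ENNReal.ofReal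
        (∑ p, ((σ p : ℤ) : ℝ) * u t (Z p ω)) ∂Pr) / 2 ^ Fintype.card ι) := by
  -- The prescribed signs `s` are made part of the functions; having modulus one, they disappear in
  -- the contraction.
  have key := lintegral_symmetrization Z hZ hind (fun t p z => ((s p : ℤ) : ℝ) * (a * h t z))
    (fun t p => ((hm t).const_mul _).const_mul _)
    (fun t p => ((hi t p).const_mul _).const_mul _)
  simp only [integral_const_mul, ← mul_sub] at key
  refine key.trans ?_
  have hsign : ∀ p, |((s p : ℤ) : ℝ)| = 1 := fun p => by
    rcases Int.units_eq_one_or (s p) with hp | hp <;> simp [hp]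
  have hcontr : ∀ ω, ∑ σ : ι → ℤˣ, ⨆ t, ENNReal.ofReal
      (∑ p, ((σ p : ℤ) : ℝ) * (((s p : ℤ) : ℝ) * (a * h t (Z p ω)))) ≤
      ENNReal.ofReal (a * L) * ∑ σ : ι → ℤˣ, ⨆ t, ENNReal.ofReal
        (∑ p, ((σ p : ℤ) : ℝ) * u t (Z p ω)) := by
    intro ω
    refine (sum_signs_contraction (fun t p => ((s p : ℤ) : ℝ) * (a * h t (Z p ω)))
      (fun t p => a * L * u t (Z p ω)) t₀ (by ext p; simp [hh₀]) (by ext p; simp [hu₀]) ?_).trans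
      (le_of_eq ?_)
    · intro p x y
      rw [← mul_sub, ← mul_sub, ← mul_sub, abs_mul, abs_mul, abs_mul, abs_mul, hsign,
        abs_of_nonneg ha, abs_of_nonneg hL, one_mul, mul_assoc]
      exact mul_le_mul_of_nonneg_left (hlip _ _ _) ha
    · rw [Finset.mul_sum]
      refine Finset.sum_congr rfl fun σ _ => ?_
      rw [ENNReal.mul_iSup]
      refine iSup_congr fun t => ?_
      rw [← ENNReal.ofReal_mul (by positivity), Finset.mul_sum]
      congr 1
      refine Finset.sum_congr rfl fun p _ => ?_
      ring
  rw [mul_assoc, ← mul_div_assoc (ENNReal.ofReal (a * L))]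
  gcongr
  rw [← lintegral_const_mul' _ _ ENNReal.ofReal_ne_top]
  exact lintegral_mono hcontr

variable {m n : ℕ}

/-- Expectation of the supremum of the centered ramp process over the blocks. -/
theorem lintegral_ramp_process_le (hn : 0 < n)
    (Z : Fin m × Fin n → Ω → S) (hZ : ∀ p, Measurable (Z p)) (hind : iIndepFun Z Pr)
    (h u : T → S → ℝ) (t₀ : T) (hm : ∀ t, Measurable (h t)) {L : ℝ} (hL : 0 ≤ L)
    (hlip : ∀ s t z, |h s z - h t z| ≤ L * |u s z - u t z|) (hh₀ : h t₀ = 0) (hu₀ : u t₀ = 0)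
    (hi : ∀ t p, Integrable (fun ω => h t (Z p ω)) Pr) (c : T → ℝ) (hc₀ : c t₀ = 0)
    (hmean : ∀ t p, ∫ ω, h t (Z p ω) ∂Pr = c t) {a : ℝ} (ha : 0 ≤ a) :
    ∫⁻ ω, ⨆ t, ENNReal.ofReal (∑ k, (ramp (a * ((∑ j, h t (Z (k, j) ω)) / n - c t)) -
        ∫ ω', ramp (a * ((∑ j, h t (Z (k, j) ω')) / n - c t)) ∂Pr)) ∂Pr ≤
      4 * ENNReal.ofReal (a / n * L) * ((∫⁻ ω, ∑ σ : Fin m × Fin n → ℤˣ, ⨆ t, ENNReal.ofReal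
        (∑ p, ((σ p : ℤ) : ℝ) * u t (Z p ω)) ∂Pr) / 2 ^ Fintype.card (Fin m × Fin n)) := by
  have hn' : (0 : ℝ) < n := by exact_mod_cast hn
  set R := (∫⁻ ω, ∑ σ : Fin m × Fin n → ℤˣ, ⨆ t, ENNReal.ofReal
        (∑ p, ((σ p : ℤ) : ℝ) * u t (Z p ω)) ∂Pr) / 2 ^ Fintype.card (Fin m × Fin n)
  let G : T → (Fin n → S) → ℝ := fun t w => a * ((∑ j, h t (w j)) / n - c t)
  have hGm : ∀ t, Measurable (G t) := fun t => by
    have := hm t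
    simp only [G]; fun_prop
  have hWm : ∀ k : Fin m, Measurable fun ω (j : Fin n) => Z (k, j) ω := fun k =>
    measurable_pi_lambda _ fun j => hZ _
  have hGWm : ∀ t k, Measurable fun ω => G t fun j => Z (k, j) ω := fun t k =>
    (hGm t).comp (hWm k)
  have hG₀ : ∀ w, G t₀ w = 0 := fun w => by simp [G, hh₀, hc₀]
  have key := lintegral_symmetrization (fun k ω (j : Fin n) => Z (k, j) ω) hWm
    (iIndepFun_curry Z hZ hind) (fun t _ w => ramp (G t w))
    (fun t _ => measurable_ramp.comp (hGm t))
    (fun t k => Integrable.of_bound (measurable_ramp.comp (hGWm t k)).aestronglyMeasurable 1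
      (ae_of_all _ fun ω => by
        rw [Real.norm_of_nonneg (ramp_nonneg _)]; exact ramp_le_one _))
  refine key.trans ?_
  -- Once the ramp is contracted away, a signed sum of block deviations is a sum over observations
  -- with signs constant on each block. A second symmetrization makes the signs free; the two
  -- factors 2 give the 4.
  have hblock : ∀ σ : Fin m → ℤˣ,
      ∫⁻ ω, ⨆ t, ENNReal.ofReal (∑ k, ((σ k : ℤ) : ℝ) * G t fun j => Z (k, j) ω) ∂Pr ≤
        2 * ENNReal.ofReal (a / n * L) * R := by
    intro σ
    refine le_trans (le_of_eq ?_) (lintegral_signed_centered_le Z hZ hind h u t₀ hm hL hlip hh₀ hu₀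
      hi (a := a / n) (by positivity) fun p => σ p.1)
    refine lintegral_congr fun ω => iSup_congr fun t => ?_
    congr 1
    rw [Fintype.sum_prod_type]
    refine Finset.sum_congr rfl fun k _ => ?_
    simp only [hmean]
    rw [← Finset.mul_sum, ← Finset.mul_sum, Finset.sum_sub_distrib]
    simp only [G, Finset.sum_const, Finset.card_univ, Fintype.card_fin, nsmul_eq_mul]
    field_simp
  have hsum : ∫⁻ ω, ∑ σ : Fin m → ℤˣ, ⨆ t, ENNReal.ofReal
      (∑ k, ((σ k : ℤ) : ℝ) * ramp (G t fun j => Z (k, j) ω)) ∂Pr ≤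
      2 ^ m * (2 * ENNReal.ofReal (a / n * L) * R) := by
    calc _ ≤ ∫⁻ ω, ∑ σ : Fin m → ℤˣ, ⨆ t, ENNReal.ofReal
          (∑ k, ((σ k : ℤ) : ℝ) * G t fun j => Z (k, j) ω) ∂Pr :=
          lintegral_mono fun ω => sum_signs_contraction
            (fun t k => ramp (G t fun j => Z (k, j) ω)) (fun t k => G t fun j => Z (k, j) ω) t₀
            (by ext k; simp [hG₀, ramp_zero]) (by ext k; simp [hG₀])
            fun k s t => abs_ramp_sub_ramp_le _ _
      _ = ∑ σ : Fin m → ℤˣ, ∫⁻ ω, ⨆ t, ENNReal.ofReal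
          (∑ k, ((σ k : ℤ) : ℝ) * G t fun j => Z (k, j) ω) ∂Pr :=
          lintegral_finsetSum _ fun σ _ => by fun_prop
      _ ≤ ∑ σ : Fin m → ℤˣ, 2 * ENNReal.ofReal (a / n * L) * R :=
          Finset.sum_le_sum fun σ _ => hblock σ
      _ = _ := by simp [Finset.card_univ]
  calc _ ≤ 2 * (2 ^ m * (2 * ENNReal.ofReal (a / n * L) * R) / 2 ^ m) := by
        rw [Fintype.card_fin]; gcongr
    _ = 4 * ENNReal.ofReal (a / n * L) * R := by
        rw [mul_comm (2 ^ m), ENNReal.mul_div_cancel_right (by simp) (by simp)]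
        ring

/-- The budget `3/32 = 1/96 + 1/24 + 1/24` collects the mean of the ramps, the expected supremum of
the centered process and the McDiarmid deviation. -/
theorem measure_many_bad_blocks_le (hm0 : 0 < m) (hn : 0 < n)
    (Z : Fin m × Fin n → Ω → S) (hZ : ∀ p, Measurable (Z p)) (hind : iIndepFun Z Pr)
    (h u : T → S → ℝ) (t₀ : T) (hm : ∀ t, Measurable (h t)) {L : ℝ} (hL : 0 < L)
    (hlip : ∀ s t z, |h s z - h t z| ≤ L * |u s z - u t z|) (hh₀ : h t₀ = 0) (hu₀ : u t₀ = 0)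
    (hL2 : ∀ t p, MemLp (fun ω => h t (Z p ω)) 2 Pr) (c : T → ℝ) (hc₀ : c t₀ = 0)
    (hmean : ∀ t p, ∫ ω, h t (Z p ω) ∂Pr = c t) {r : ℝ} (hr : 0 < r)
    (hvar : ∀ t p, variance (fun ω => h t (Z p ω)) Pr ≤ n * (r ^ 4 / 1536))
    (hrad : (∫⁻ ω, ∑ σ : Fin m × Fin n → ℤˣ, ⨆ t, ENNReal.ofReal
        (∑ p, ((σ p : ℤ) : ℝ) * u t (Z p ω)) ∂Pr) / 2 ^ Fintype.card (Fin m × Fin n) ≤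
      ENNReal.ofReal (m * n * (r ^ 2 / (768 * L)))) :
    Pr {ω | ∃ t, 3 / 32 * (m : ℝ) ≤ (Finset.univ.filter fun k =>
        r ^ 2 / 4 < |(∑ j, h t (Z (k, j) ω)) / n - c t|).card} ≤
      ENNReal.ofReal (Real.exp (-(m : ℝ) / 1152)) := by
  have hn' : (0 : ℝ) < n := by exact_mod_cast hn
  have hm' : (0 : ℝ) < m := by exact_mod_cast hm0
  let W : Fin m → Ω → Fin n → S := fun k ω j => Z (k, j) ω
  have hWm : ∀ k, Measurable (W k) := fun k => measurable_pi_lambda _ fun j => hZ _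
  have hWall : Measurable fun ω k => W k ω := measurable_pi_lambda _ hWm
  -- The scale `8 / r²` sends the threshold `r² / 4` to 2, where the ramp reaches 1.
  let ψ : T → (Fin n → S) → ℝ := fun t w => ramp (8 / r ^ 2 * ((∑ j, h t (w j)) / n - c t))
  have hψm : ∀ t, Measurable (ψ t) := fun t => by
    have := hm t
    exact measurable_ramp.comp (by fun_prop)
  let e : T → Fin m → ℝ := fun t k => ∫ ω, ψ t (W k ω) ∂Pr
  have he0 : ∀ t k, 0 ≤ e t k := fun t k => integral_nonneg fun ω => ramp_nonneg _
  have he : ∀ t k, e t k ≤ 1 / 96 := by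
    intro t k
    obtain ⟨h1, h2⟩ := integral_sq_mean_sub_le hn (fun j ω => h t (Z (k, j) ω))
      (fun j => hL2 t _) ((hind.precomp (g := fun j => (k, j)) (Prod.mk_right_injective k)).comp
        (fun _ => h t) fun _ => hm t) (c t) (r ^ 4 / 1536) (fun j => hmean t _) (fun j => hvar t _)
    calc e t k ≤ ∫ ω, 16 / r ^ 4 * ((∑ j, h t (Z (k, j) ω)) / n - c t) ^ 2 ∂Pr := by
          refine integral_mono_of_nonneg (ae_of_all _ fun ω => ramp_nonneg _) (h1.const_mul _)
            (ae_of_all _ fun ω => (ramp_le_sq _).trans (le_of_eq ?_))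
          simp only [W]
          field_simp
          ring
      _ ≤ 16 / r ^ 4 * (r ^ 4 / 1536) := by
          rw [integral_const_mul]
          exact mul_le_mul_of_nonneg_left h2 (by positivity)
      _ = 1 / 96 := by field_simp; norm_num
  let D : T → (Fin m → Fin n → S) → ℝ := fun t w => ∑ k, (ψ t (w k) - e t k)
  have hDm : ∀ t, Measurable (D t) := fun t => by
    have := hψm t
    simp only [D]; fun_prop
  have hDle : ∀ w t, D t w ≤ m := fun w t => by
    calc D t w ≤ ∑ k : Fin m, (1 : ℝ) :=
          Finset.sum_le_sum fun k _ => by linarith [ramp_le_one (8 / r ^ 2 *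
            ((∑ j, h t (w k j)) / n - c t)), he0 t k]
      _ = m := by simp
  let g : (Fin m → Fin n → S) → ℝ := fun w => (⨆ t, ENNReal.ofReal (D t w)).toReal
  have hfin : ∀ w, (⨆ t, ENNReal.ofReal (D t w)) ≤ ENNReal.ofReal m := fun w =>
    iSup_le fun t => ENNReal.ofReal_le_ofReal (hDle w t)
  have hgm : Measurable g := by
    simp only [g]; fun_prop
  have hgC : ∀ w, |g w| ≤ m := fun w => by
    rw [abs_of_nonneg ENNReal.toReal_nonneg]
    exact ENNReal.toReal_le_of_le_ofReal hm'.le (hfin w)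
  have hgd : ∀ w k x, |g (Function.update w k x) - g w| ≤ 1 := by
    intro w k x
    refine abs_toReal_iSup_sub_le (hDle _) (hDle _) zero_le_one fun t => ?_
    have : D t (Function.update w k x) - D t w = ψ t x - ψ t (w k) := by
      simp only [D]
      rw [← Finset.sum_sub_distrib, Finset.sum_eq_single k]
      · simp
      · intro l _ hl; simp [Function.update_of_ne hl]
      · simp
    rw [this, abs_le]
    have h1 := ramp_nonneg (8 / r ^ 2 * ((∑ j, h t (x j)) / n - c t))
    have h2 := ramp_le_one (8 / r ^ 2 * ((∑ j, h t (x j)) / n - c t))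
    have h3 := ramp_nonneg (8 / r ^ 2 * ((∑ j, h t (w k j)) / n - c t))
    have h4 := ramp_le_one (8 / r ^ 2 * ((∑ j, h t (w k j)) / n - c t))
    simp only [ψ]
    constructor <;> linarith
  have hEg : ∫ ω, g (fun k => W k ω) ∂Pr ≤ m / 24 := by
    rw [integral_toReal]
    · refine ENNReal.toReal_le_of_le_ofReal (by positivity) ?_
      refine (lintegral_ramp_process_le hn Z hZ hind h u t₀ hm hL.le hlip hh₀ hu₀
        (fun t p => (hL2 t p).integrable (by norm_num)) c hc₀ hmean
        (a := 8 / r ^ 2) (by positivity)).trans ?_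
      refine (mul_le_mul_right hrad _).trans (le_of_eq ?_)
      rw [show (4 : ℝ≥0∞) = ENNReal.ofReal 4 by simp, ← ENNReal.ofReal_mul (by norm_num),
        ← ENNReal.ofReal_mul (by positivity)]
      congr 1
      field_simp
      norm_num
    · exact (Measurable.iSup fun t => ((hDm t).comp hWall).ennreal_ofReal).aemeasurable
    · exact ae_of_all _ fun ω => (hfin _).trans_lt ENNReal.ofReal_lt_top
  have hmcd := measure_bounded_differences_le W hWm (iIndepFun_curry Z hZ hind) g hgm hgd m hgC
    (ε := m / 24) (by positivity)
  have hexp : -((m : ℝ) / 24) ^ 2 / (2 * m) = -(m : ℝ) / 1152 := by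
    field_simp; norm_num
  rw [hexp] at hmcd
  refine le_trans (measure_mono ?_) ((ENNReal.le_ofReal_iff_toReal_le (measure_ne_top _ _)
    (Real.exp_pos _).le).2 hmcd)
  rintro ω ⟨t, ht⟩
  have hcount : ((Finset.univ.filter fun k =>
      r ^ 2 / 4 < |(∑ j, h t (Z (k, j) ω)) / n - c t|).card : ℝ) ≤ ∑ k, ψ t (W k ω) := by
    rw [Finset.card_filter]
    push_cast
    refine Finset.sum_le_sum fun k _ => ?_
    split_ifs with hk
    · refine (ramp_eq_one ?_).ge
      rw [abs_mul, abs_of_nonneg (by positivity : (0 : ℝ) ≤ 8 / r ^ 2)]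
      calc (2 : ℝ) = 8 / r ^ 2 * (r ^ 2 / 4) := by field_simp; norm_num
        _ ≤ _ := mul_le_mul_of_nonneg_left hk.le (by positivity)
    · exact ramp_nonneg _
  have hDg : D t (fun k => W k ω) ≤ g fun k => W k ω :=
    (ENNReal.ofReal_le_iff_le_toReal (ne_top_of_le_ne_top ENNReal.ofReal_ne_top (hfin _))).1
      (le_iSup (fun t => ENNReal.ofReal (D t fun k => W k ω)) t)
  have hesum : ∑ k, e t k ≤ m / 96 := by
    calc ∑ k, e t k ≤ ∑ k : Fin m, (1 / 96 : ℝ) := Finset.sum_le_sum fun k _ => he t k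
      _ = m / 96 := by simp; ring
  have hDs : D t (fun k => W k ω) = ∑ k, ψ t (W k ω) - ∑ k, e t k := Finset.sum_sub_distrib _ _
  simp only [Set.mem_ofPred_eq]
  linarith

end BadBlocks

end MinmaxMOM

end

/-! ### Deterministic argument: medians, convexity and approximation. -/

noncomputable section

namespace MinmaxMOM

section Deterministic

/-- At least half of the indices have `x k ≤ m` and more than half have `a ≤ x k`, so some index has
both. -/
theorem IsMedian.le_of_lt_card {K : ℕ} {x : Fin K → ℝ} {m a : ℝ} (h : IsMedian x m)
    (ha : K < 2 * (Finset.univ.filter fun k => a ≤ x k).card) : a ≤ m := by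
  by_contra hlt
  push Not at hlt
  have hdisj : Disjoint (Finset.univ.filter fun k => x k ≤ m)
      (Finset.univ.filter fun k => a ≤ x k) := by
    rw [Finset.disjoint_filter]
    intro k _ h1 h2
    linarith
  have := Finset.card_union_of_disjoint hdisj
  have h2 := Finset.card_le_univ ((Finset.univ.filter fun k => x k ≤ m) ∪
    Finset.univ.filter fun k => a ≤ x k)
  rw [Fintype.card_fin] at h2
  have h3 := h.1
  omega

/-- The selection rule need not be odd, so exchanging the two functions in a loss difference goes
through this property instead. -/
theorem IsMedian.neg {K : ℕ} {x : Fin K → ℝ} {m : ℝ} (h : IsMedian x m) :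
    IsMedian (fun k => -x k) (-m) := by
  refine ⟨?_, ?_⟩
  · simpa only [neg_le_neg_iff] using h.2
  · simpa only [neg_le_neg_iff] using h.1

variable {𝒳 𝒴 : Type*} {ℓ : ℝ → 𝒴 → ℝ} {Ybar : Set ℝ} {L : ℝ} {F : Set (𝒳 → ℝ)} {fs : 𝒳 → ℝ}

/-- The point `fs + t (f - fs)` of the segment from `fs` to `f`. -/
def segPt (fs f : 𝒳 → ℝ) (t : ℝ) : 𝒳 → ℝ := (1 - t) • fs + t • f

theorem segPt_zero (fs f : 𝒳 → ℝ) : segPt fs f 0 = fs := by simp [segPt]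

theorem segPt_one (fs f : 𝒳 → ℝ) : segPt fs f 1 = f := by simp [segPt]

theorem segPt_mem (hF : Convex ℝ F) (hfs : fs ∈ F) {f : 𝒳 → ℝ} (hf : f ∈ F) {t : ℝ}
    (ht : t ∈ Set.Icc (0 : ℝ) 1) : segPt fs f t ∈ F :=
  hF hfs hf (by linarith [ht.2]) ht.1 (by ring)

theorem lossDiff_segPt_le (hconv : ∀ y, ConvexOn ℝ Ybar fun u => ℓ u y)
    (hFY : ∀ f ∈ F, ∀ x, f x ∈ Ybar) (hfs : fs ∈ F) {f : 𝒳 → ℝ} (hf : f ∈ F) {t : ℝ}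
    (ht : t ∈ Set.Icc (0 : ℝ) 1) (z : 𝒳 × 𝒴) :
    lossDiff ℓ (segPt fs f t) fs z ≤ t * lossDiff ℓ f fs z := by
  have := (hconv z.2).2 (hFY fs hfs z.1) (hFY f hf z.1) (sub_nonneg.2 ht.2) ht.1 (by ring)
  simp only [lossDiff, segPt, Pi.add_apply, Pi.smul_apply, smul_eq_mul] at this ⊢
  linarith

theorem blockMean_mono {N : ℕ} {S : Type*} (b : Finset (Fin N)) (z : Fin N → S) {g g' : S → ℝ}
    (h : ∀ s, g s ≤ g' s) : blockMean b z g ≤ blockMean b z g' := by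
  unfold blockMean
  gcongr
  exact h _

theorem blockMean_const_mul {N : ℕ} {S : Type*} (b : Finset (Fin N)) (z : Fin N → S) (a : ℝ)
    (g : S → ℝ) : blockMean b z (fun s => a * g s) = a * blockMean b z g := by
  unfold blockMean
  rw [← Finset.mul_sum, mul_div_assoc]

theorem blockMean_lossDiff_comm {N : ℕ} (b : Finset (Fin N)) (z : Fin N → 𝒳 × 𝒴)
    (f g : 𝒳 → ℝ) : blockMean b z (lossDiff ℓ f g) = -blockMean b z (lossDiff ℓ g f) := by
  unfold blockMean lossDiff
  rw [← neg_div, ← Finset.sum_neg_distrib]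
  simp only [neg_sub]

theorem abs_lossDiff_sub_le (hlip : ∀ y, ∀ u ∈ Ybar, ∀ v ∈ Ybar, |ℓ u y - ℓ v y| ≤ L * |u - v|)
    (hFY : ∀ f ∈ F, ∀ x, f x ∈ Ybar) {f g : 𝒳 → ℝ} (hf : f ∈ F) (hg : g ∈ F) (fs : 𝒳 → ℝ)
    (z : 𝒳 × 𝒴) : |lossDiff ℓ f fs z - lossDiff ℓ g fs z| ≤ L * |f z.1 - g z.1| := by
  simp only [lossDiff, sub_sub_sub_cancel_right]
  exact hlip _ _ (hFY f hf _) _ (hFY g hg _)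

theorem tendsto_blockMean_lossDiff
    (hlip : ∀ y, ∀ u ∈ Ybar, ∀ v ∈ Ybar, |ℓ u y - ℓ v y| ≤ L * |u - v|)
    (hFY : ∀ f ∈ F, ∀ x, f x ∈ Ybar) {N : ℕ} (b : Finset (Fin N)) (z : Fin N → 𝒳 × 𝒴)
    {f : 𝒳 → ℝ} (hf : f ∈ F) {u : ℕ → 𝒳 → ℝ} (hu : ∀ n, u n ∈ F)
    (hlim : ∀ x, Tendsto (fun n => u n x) atTop (𝓝 (f x))) :
    Tendsto (fun n => blockMean b z (lossDiff ℓ (u n) fs)) atTop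
      (𝓝 (blockMean b z (lossDiff ℓ f fs))) := by
  unfold blockMean
  refine (tendsto_finsetSum _ fun i _ => ?_).div_const _
  rw [tendsto_iff_dist_tendsto_zero]
  have h0 : Tendsto (fun n => L * |u n (z i).1 - f (z i).1|) atTop (𝓝 0) := by
    have := (tendsto_iff_dist_tendsto_zero.1 (hlim (z i).1)).const_mul L
    simpa [Real.dist_eq] using this
  refine squeeze_zero (fun n => dist_nonneg) (fun n => ?_) h0
  rw [Real.dist_eq]
  exact abs_lossDiff_sub_le hlip hFY (hu n) hf fs _

variable [MeasurableSpace 𝒳] [MeasurableSpace 𝒴] {P : Measure (𝒳 × 𝒴)}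

/-- More than half of the block means of the excess loss of `f` are `r² / 4`-close to the excess
risk of `f`. -/
def MostBlocksGood (ℓ : ℝ → 𝒴 → ℝ) (P : Measure (𝒳 × 𝒴)) (fs : 𝒳 → ℝ) {N K : ℕ}
    (B : Fin K → Finset (Fin N)) (z : Fin N → 𝒳 × 𝒴) (r : ℝ) (f : 𝒳 → ℝ) : Prop :=
  K < 2 * (Finset.univ.filter fun k =>
    |blockMean (B k) z (lossDiff ℓ f fs) - excessRisk ℓ P fs f| ≤ r ^ 2 / 4).card

/-- Badness of a block is a strict inequality, hence an open condition: the bad blocks of the limit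
are eventually bad for `u n`. -/
theorem MostBlocksGood.of_tendsto {N K : ℕ} {B : Fin K → Finset (Fin N)} {z : Fin N → 𝒳 × 𝒴}
    {r : ℝ} {f : 𝒳 → ℝ} {u : ℕ → 𝒳 → ℝ}
    (hmean : ∀ k, Tendsto (fun n => blockMean (B k) z (lossDiff ℓ (u n) fs)) atTop
      (𝓝 (blockMean (B k) z (lossDiff ℓ f fs))))
    (hrisk : Tendsto (fun n => excessRisk ℓ P fs (u n)) atTop (𝓝 (excessRisk ℓ P fs f)))
    (hu : ∀ᶠ n in atTop, MostBlocksGood ℓ P fs B z r (u n)) :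
    MostBlocksGood ℓ P fs B z r f := by
  have hbad : ∀ᶠ n in atTop, ∀ k,
      r ^ 2 / 4 < |blockMean (B k) z (lossDiff ℓ f fs) - excessRisk ℓ P fs f| →
      r ^ 2 / 4 < |blockMean (B k) z (lossDiff ℓ (u n) fs) - excessRisk ℓ P fs (u n)| := by
    rw [eventually_all]
    intro k
    by_cases hk : r ^ 2 / 4 < |blockMean (B k) z (lossDiff ℓ f fs) - excessRisk ℓ P fs f|
    · filter_upwards [(((hmean k).sub hrisk).abs).eventually (lt_mem_nhds hk)] with n hn _
      exact hn
    · exact Eventually.of_forall fun n h => absurd h hk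
  obtain ⟨n, hn, hgood⟩ := (hbad.and hu).exists
  refine lt_of_lt_of_le hgood (Nat.mul_le_mul_left 2 (Finset.card_le_card ?_))
  intro k
  simp only [Finset.mem_filter, Finset.mem_univ, true_and]
  intro h
  by_contra h2
  exact absurd (hn k (not_le.1 h2)) (not_lt.2 h)

theorem excessRisk_segPt_le (hconv : ∀ y, ConvexOn ℝ Ybar fun u => ℓ u y)
    (hF : Convex ℝ F) (hFY : ∀ f ∈ F, ∀ x, f x ∈ Ybar) (hfs : IsOracle ℓ P F fs) {f : 𝒳 → ℝ}
    (hf : f ∈ F) {t : ℝ} (ht : t ∈ Set.Icc (0 : ℝ) 1) :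
    excessRisk ℓ P fs (segPt fs f t) ≤ t * excessRisk ℓ P fs f := by
  unfold excessRisk
  rw [← integral_const_mul]
  exact integral_mono (hfs.integrable _ (segPt_mem hF hfs.mem hf ht))
    ((hfs.integrable f hf).const_mul t)
    fun z => lossDiff_segPt_le hconv hFY hfs.mem hf ht z

/-- A law with the same excess risk, under which the class is integrable, makes the excess risk
Lipschitz along segments. -/
theorem continuousOn_excessRisk_segPt
    (hlip : ∀ y, ∀ u ∈ Ybar, ∀ v ∈ Ybar, |ℓ u y - ℓ v y| ≤ L * |u - v|)
    (hF : Convex ℝ F) (hFY : ∀ f ∈ F, ∀ x, f x ∈ Ybar) (hfs : fs ∈ F)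
    (hℓm : ∀ f ∈ F, Measurable fun z : 𝒳 × 𝒴 => ℓ (f z.1) z.2) {μ : Measure (𝒳 × 𝒴)}
    (hint : ∀ f ∈ F, Integrable (fun z : 𝒳 × 𝒴 => f z.1) μ)
    (hrisk : ∀ f ∈ F, excessRisk ℓ μ fs f = excessRisk ℓ P fs f) {f : 𝒳 → ℝ} (hf : f ∈ F) :
    ContinuousOn (fun t => excessRisk ℓ P fs (segPt fs f t)) (Set.Icc 0 1) := by
  have hI : ∀ g ∈ F, Integrable (lossDiff ℓ g fs) μ := fun g hg => by
    refine (((hint g hg).sub (hint fs hfs)).norm.const_mul L).mono'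
      (((hℓm g hg).sub (hℓm fs hfs)).aestronglyMeasurable) (ae_of_all _ fun z => ?_)
    simpa [lossDiff] using hlip z.2 _ (hFY g hg _) _ (hFY fs hfs _)
  have hd : ∀ s ∈ Set.Icc (0 : ℝ) 1, ∀ t ∈ Set.Icc (0 : ℝ) 1,
      |excessRisk ℓ P fs (segPt fs f s) - excessRisk ℓ P fs (segPt fs f t)| ≤
        (L * ∫ z, |f z.1 - fs z.1| ∂μ) * |s - t| := by
    intro s hs t ht
    have hs' := segPt_mem hF hfs hf hs
    have ht' := segPt_mem hF hfs hf ht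
    rw [← hrisk _ hs', ← hrisk _ ht']
    unfold excessRisk
    rw [← integral_sub (hI _ hs') (hI _ ht'), mul_right_comm, ← integral_const_mul]
    refine norm_integral_le_of_norm_le (f := fun z => lossDiff ℓ (segPt fs f s) fs z -
      lossDiff ℓ (segPt fs f t) fs z) (g := fun z => L * |s - t| * |f z.1 - fs z.1|)
      (((hint f hf).sub (hint fs hfs)).abs.const_mul _) (ae_of_all _ fun z => ?_)
    refine (abs_lossDiff_sub_le hlip hFY hs' ht' fs z).trans (le_of_eq ?_)
    have : segPt fs f s z.1 - segPt fs f t z.1 = (s - t) * (f z.1 - fs z.1) := by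
      simp only [segPt, Pi.add_apply, Pi.smul_apply, smul_eq_mul]; ring
    rw [this, abs_mul, mul_assoc]
  intro t ht
  rw [ContinuousWithinAt, tendsto_iff_dist_tendsto_zero]
  have h0 : Tendsto (fun s : ℝ => (L * ∫ z, |f z.1 - fs z.1| ∂μ) * |s - t|)
      (𝓝[Set.Icc 0 1] t) (𝓝 0) := by
    have : Continuous fun s : ℝ => (L * ∫ z, |f z.1 - fs z.1| ∂μ) * |s - t| := by fun_prop
    simpa using (this.tendsto t).mono_left nhdsWithin_le_nhds
  refine squeeze_zero' (Eventually.of_forall fun _ => dist_nonneg) ?_ h0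
  filter_upwards [self_mem_nhdsWithin] with s hs
  exact hd s hs t ht

theorem excessRisk_self (fs : 𝒳 → ℝ) : excessRisk ℓ P fs fs = 0 := by
  simp [excessRisk, lossDiff]

/-- It suffices to control the block means on a countable subclass. -/
theorem mostBlocksGood_of_countable
    (hlip : ∀ y, ∀ u ∈ Ybar, ∀ v ∈ Ybar, |ℓ u y - ℓ v y| ≤ L * |u - v|)
    (hconv : ∀ y, ConvexOn ℝ Ybar fun u => ℓ u y)
    (hF : Convex ℝ F) (hFY : ∀ f ∈ F, ∀ x, f x ∈ Ybar) (hfs : IsOracle ℓ P F fs)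
    (hcont : ∀ f ∈ F, ContinuousOn (fun t => excessRisk ℓ P fs (segPt fs f t)) (Set.Icc 0 1))
    {F₀ : Set (𝒳 → ℝ)} (hF₀ : F₀ ⊆ F)
    (happrox : ∀ f ∈ F, ∃ u : ℕ → 𝒳 → ℝ, (∀ n, u n ∈ F₀) ∧
      (∀ x, Tendsto (fun n => u n x) atTop (𝓝 (f x))) ∧
      Tendsto (fun n => excessRisk ℓ P fs (u n)) atTop (𝓝 (excessRisk ℓ P fs f)))
    {N K : ℕ} {B : Fin K → Finset (Fin N)} {z : Fin N → 𝒳 × 𝒴} {r : ℝ} (hr : 0 < r)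
    (h₀ : ∀ f ∈ F₀ ∩ localClass ℓ P F fs r, MostBlocksGood ℓ P fs B z r f) :
    ∀ f ∈ localClass ℓ P F fs r, MostBlocksGood ℓ P fs B z r f := by
  -- With strict inequality the approximants from `F₀` eventually enter the localized class. The
  -- boundary case is then reached by shrinking `f` slightly towards `fs`, which makes the risk
  -- strictly smaller than `r²`.
  have hlt : ∀ f ∈ F, excessRisk ℓ P fs f < r ^ 2 → MostBlocksGood ℓ P fs B z r f := by
    intro f hf hfr
    obtain ⟨u, hu, hux, hur⟩ := happrox f hf
    refine MostBlocksGood.of_tendsto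
      (fun k => tendsto_blockMean_lossDiff hlip hFY _ z hf (fun n => hF₀ (hu n)) hux) hur ?_
    filter_upwards [hur.eventually (gt_mem_nhds hfr)] with n hn
    exact h₀ _ ⟨hu n, hF₀ (hu n), hn.le⟩
  rintro f ⟨hf, hfr⟩
  have hs : ∀ n : ℕ, 1 - 1 / ((n : ℝ) + 1) ∈ Set.Icc (0 : ℝ) 1 := fun n => by
    have h1 : 0 ≤ 1 / ((n : ℝ) + 1) := by positivity
    have h2 : 1 / ((n : ℝ) + 1) ≤ 1 := by
      rw [div_le_one (by positivity)]; linarith [(Nat.cast_nonneg n : (0 : ℝ) ≤ n)]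
    constructor <;> linarith
  have hlim : Tendsto (fun n : ℕ => 1 - 1 / ((n : ℝ) + 1)) atTop (𝓝 1) := by
    simpa using tendsto_const_nhds.sub (tendsto_one_div_add_atTop_nhds_zero_nat (𝕜 := ℝ))
  have hmem : ∀ n : ℕ, segPt fs f (1 - 1 / ((n : ℝ) + 1)) ∈ F := fun n =>
    segPt_mem hF hfs.mem hf (hs n)
  refine MostBlocksGood.of_tendsto (u := fun n : ℕ => segPt fs f (1 - 1 / ((n : ℝ) + 1)))
    (fun k => tendsto_blockMean_lossDiff hlip hFY _ z hf hmem fun x => ?_) ?_ ?_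
  · have : Continuous fun t : ℝ => segPt fs f t x := by
      simp only [segPt, Pi.add_apply, Pi.smul_apply, smul_eq_mul]; fun_prop
    have h1 := (this.tendsto 1).comp hlim
    rwa [segPt_one] at h1
  · have h1 := (hcont f hf) 1 ⟨zero_le_one, le_rfl⟩
    have h2 := h1.tendsto.comp (tendsto_nhdsWithin_iff.2 ⟨hlim, Eventually.of_forall hs⟩)
    rwa [segPt_one] at h2
  · refine Eventually.of_forall fun n => hlt _ (hmem n) ?_
    refine (excessRisk_segPt_le hconv hF hFY hfs hf (hs n)).trans_lt ?_
    have h1 : 0 < 1 / ((n : ℝ) + 1) := by positivity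
    calc _ ≤ (1 - 1 / ((n : ℝ) + 1)) * r ^ 2 := mul_le_mul_of_nonneg_left hfr (hs n).1
      _ < r ^ 2 := by nlinarith [pow_pos hr 2]

theorem excessRisk_le_of_mostBlocksGood
    (hconv : ∀ y, ConvexOn ℝ Ybar fun u => ℓ u y)
    (hF : Convex ℝ F) (hFY : ∀ f ∈ F, ∀ x, f x ∈ Ybar) (hfs : IsOracle ℓ P F fs)
    (hcont : ∀ f ∈ F, ContinuousOn (fun t => excessRisk ℓ P fs (segPt fs f t)) (Set.Icc 0 1))
    {N K : ℕ} {B : Fin K → Finset (Fin N)} {z : Fin N → 𝒳 × 𝒴} {r : ℝ} (hr : 0 < r)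
    (hgood : ∀ f ∈ localClass ℓ P F fs r, MostBlocksGood ℓ P fs B z r f)
    {med : (Fin K → ℝ) → ℝ} (hmed : ∀ x, IsMedian x (med x)) {fhat : 𝒳 → ℝ}
    (hfhat : IsMinmaxMOM med B ℓ F z fhat) : excessRisk ℓ P fs fhat ≤ r ^ 2 := by
  have hr2 : 0 < r ^ 2 := pow_pos hr 2
  have hlarge : ∀ f ∈ F, r ^ 2 < excessRisk ℓ P fs f →
      K < 2 * (Finset.univ.filter fun k =>
        3 / 4 * r ^ 2 ≤ blockMean (B k) z (lossDiff ℓ f fs)).card := by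
    intro f hf hfr
    have hivt := intermediate_value_Icc (zero_le_one' ℝ) (hcont f hf)
    rw [segPt_zero, segPt_one, excessRisk_self] at hivt
    obtain ⟨t, ht, htr⟩ := hivt ⟨hr2.le, hfr.le⟩
    simp only at htr
    refine lt_of_lt_of_le (hgood (segPt fs f t) ⟨segPt_mem hF hfs.mem hf ht, htr.le⟩)
      (Nat.mul_le_mul_left 2 (Finset.card_le_card ?_))
    intro k
    simp only [Finset.mem_filter, Finset.mem_univ, true_and, htr]
    intro hk
    have h1 := (abs_le.1 hk).1
    have h2 : blockMean (B k) z (lossDiff ℓ (segPt fs f t) fs) ≤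
        t * blockMean (B k) z (lossDiff ℓ f fs) := by
      rw [← blockMean_const_mul]
      exact blockMean_mono _ _ fun s => lossDiff_segPt_le hconv hFY hfs.mem hf ht s
    by_contra h3
    push Not at h3
    -- `t = 0` would force `3 r² / 4 ≤ 0`; for `t > 0`, the bound uses `t ≤ 1`.
    rcases ht.1.eq_or_lt with h0 | h0
    · have h4 : t * blockMean (B k) z (lossDiff ℓ f fs) = 0 := by rw [← h0, zero_mul]
      linarith
    · nlinarith [mul_lt_mul_of_pos_left h3 h0, mul_le_mul_of_nonneg_right ht.2 hr2.le]
  by_contra hcon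
  push Not at hcon
  -- Most block means of `ℓ_g - ℓ_{fs}` are at least `-r² / 4`: inside the localized class because
  -- the excess risk is nonnegative, outside because they are even at least `3 r² / 4`.
  have hup : criterion med B ℓ F z fs ≤ ((r ^ 2 / 4 : ℝ) : EReal) := by
    refine iSup₂_le fun g hg => EReal.coe_le_coe_iff.2 ?_
    have hneg := (hmed fun k => blockMean (B k) z (lossDiff ℓ fs g)).neg
    simp only [blockMean_lossDiff_comm (ℓ := ℓ) _ _ fs g, neg_neg] at hneg
    have : -(r ^ 2 / 4) ≤ -mom med B z (lossDiff ℓ fs g) := by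
      unfold mom
      simp only [blockMean_lossDiff_comm (ℓ := ℓ) _ _ fs g]
      refine hneg.le_of_lt_card ?_
      rcases le_or_gt (excessRisk ℓ P fs g) (r ^ 2) with hgr | hgr
      · refine lt_of_lt_of_le (hgood g ⟨hg, hgr⟩)
          (Nat.mul_le_mul_left 2 (Finset.card_le_card ?_))
        intro k
        simp only [Finset.mem_filter, Finset.mem_univ, true_and]
        intro hk
        linarith [(abs_le.1 hk).1, hfs.le g hg]
      · refine lt_of_lt_of_le (hlarge g hg hgr)
          (Nat.mul_le_mul_left 2 (Finset.card_le_card ?_))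
        intro k
        simp only [Finset.mem_filter, Finset.mem_univ, true_and]
        intro hk
        linarith
    linarith
  have hlow : ((3 / 4 * r ^ 2 : ℝ) : EReal) ≤ criterion med B ℓ F z fhat := by
    refine le_trans (EReal.coe_le_coe_iff.2 ?_)
      (le_iSup₂ (f := fun g (_ : g ∈ F) => ((mom med B z (lossDiff ℓ fhat g) : ℝ) : EReal))
        fs hfs.mem)
    exact (hmed _).le_of_lt_card (hlarge fhat hfhat.1 hcon)
  have := EReal.coe_le_coe_iff.1 (hlow.trans ((hfhat.2 fs hfs.mem).trans hup))
  linarith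

end Deterministic

end MinmaxMOM

end

/-! ### Passage to the clean blocks and construction of the event. -/

noncomputable section

namespace MinmaxMOM

section Assembly

theorem sum_signs_comp_injective {κ ι : Type*} [Fintype κ] [DecidableEq κ] [Fintype ι]
    [DecidableEq ι] (e : κ → ι) (he : Function.Injective e) (H : (κ → ℤˣ) → ℝ≥0∞) :
    (∑ τ, H τ) / 2 ^ Fintype.card κ = (∑ σ : ι → ℤˣ, H fun k => σ (e k)) / 2 ^ Fintype.card ι := by
  classical
  let E : κ ≃ {i // i ∈ Set.range e} := Equiv.ofInjective e he
  have h1 := sum_signs_restrict (fun i => i ∈ Set.range e) fun τ => H fun k => τ (E k)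
  rw [Fintype.card_congr E, ← Equiv.sum_comp (E.arrowCongr (Equiv.refl ℤˣ)).symm H]
  convert h1 <;> rfl

/-- Reverse Fatou: each tail union contains some `A n`, and the tail unions decrease to the limsup.
-/
theorem measure_limsup_ge {Ω : Type*} [MeasurableSpace Ω] {Pr : Measure Ω} [IsFiniteMeasure Pr]
    {A : ℕ → Set Ω} (hA : ∀ n, MeasurableSet (A n)) {δ : ℝ≥0∞} (hδ : ∀ n, δ ≤ Pr (A n)) :
    δ ≤ Pr (limsup A atTop) := by
  rw [limsup_eq_iInf_iSup_of_nat]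
  simp only [Set.iInf_eq_iInter, Set.iSup_eq_iUnion]
  have hanti : Antitone fun n => ⋃ i, ⋃ (_ : i ≥ n), A i := fun a b hab =>
    Set.iUnion_mono fun i => Set.iUnion_subset fun hi =>
      Set.subset_iUnion_of_subset (hab.trans hi) (le_refl (A i))
  refine ge_of_tendsto' (tendsto_measure_iInter_atTop (μ := Pr)
    (fun n => (MeasurableSet.iUnion fun i => MeasurableSet.iUnion fun _ =>
      hA i).nullMeasurableSet) hanti ⟨0, measure_ne_top _ _⟩) fun n =>
    (hδ n).trans (measure_mono (Set.subset_iUnion₂_of_subset n le_rfl le_rfl))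

variable {Ω 𝒳 𝒴 : Type*} [MeasurableSpace Ω] [MeasurableSpace 𝒳] [MeasurableSpace 𝒴]
  {Pr : Measure Ω} {P : Measure (𝒳 × 𝒴)} {ℓ : ℝ → 𝒴 → ℝ} {F : Set (𝒳 → ℝ)} {fs : 𝒳 → ℝ}
  {N : ℕ} {Z : Fin N → Ω → 𝒳 × 𝒴} {I : Finset (Fin N)}

/-- The Rademacher average over an injectively indexed subsample of a subclass is bounded by the
Rademacher complexity. -/
theorem lintegral_signs_le_rademacherTerm {κ T : Type*} [Fintype κ] [DecidableEq κ] [Nonempty κ]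
    (e : κ → Fin N) (he : Function.Injective e) (heI : ∀ k, e k ∈ I) {n₀ : ℕ}
    (hcard : (n₀ : ℝ) / 2 ≤ Fintype.card κ) {r : ℝ} (f : T → 𝒳 → ℝ)
    (hf : ∀ t, f t ∈ localClass ℓ P F fs r) :
    (∫⁻ ω, ∑ σ : κ → ℤˣ, ⨆ t, ENNReal.ofReal (∑ k, ((σ k : ℤ) : ℝ) *
        (f t (Z (e k) ω).1 - fs (Z (e k) ω).1)) ∂Pr) / 2 ^ Fintype.card κ ≤
      Fintype.card κ * rademacherTerm ℓ P F fs Pr Z I n₀ r := by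
  have hκ : (0 : ℝ) < Fintype.card κ := by exact_mod_cast Fintype.card_pos
  let J : Finset (Fin N) := Finset.univ.map ⟨e, he⟩
  have hJI : J ⊆ I := fun i hi => by
    obtain ⟨k, -, rfl⟩ := Finset.mem_map.1 hi
    exact heI k
  have hJ : J.card = Fintype.card κ := by simp [J, Finset.card_univ]
  have hle : ∫⁻ ω, (∑ σ : Fin N → ℤˣ, ⨆ f ∈ localClass ℓ P F fs r,
      ENNReal.ofReal |(1 / (J.card : ℝ)) *
        ∑ i ∈ J, ((σ i : ℤ) : ℝ) * (f (Z i ω).1 - fs (Z i ω).1)|) / 2 ^ N ∂Pr ≤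
      rademacherTerm ℓ P F fs Pr Z I n₀ r := by
    unfold rademacherTerm
    exact le_iSup_of_le J (le_iSup_of_le hJI (le_iSup_of_le (by rw [hJ]; exact hcard) le_rfl))
  refine le_trans ?_ (mul_le_mul_right hle _)
  rw [div_eq_mul_inv, ← lintegral_mul_const' _ _ (by simp),
    ← lintegral_const_mul' _ _ (ENNReal.natCast_ne_top _)]
  refine lintegral_mono fun ω => ?_
  rw [← div_eq_mul_inv, sum_signs_comp_injective e he, Fintype.card_fin, ← mul_div_assoc]
  gcongr
  rw [Finset.mul_sum]
  refine Finset.sum_le_sum fun σ _ => iSup_le fun t => ?_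
  refine le_trans ?_ (mul_le_mul_right (le_iSup₂ (f := fun f (_ : f ∈ localClass ℓ P F fs r) =>
    ENNReal.ofReal |(1 / (J.card : ℝ)) *
      ∑ i ∈ J, ((σ i : ℤ) : ℝ) * (f (Z i ω).1 - fs (Z i ω).1)|) (f t) (hf t)) _)
  rw [← ENNReal.ofReal_natCast, ← ENNReal.ofReal_mul (by positivity), hJ]
  refine ENNReal.ofReal_le_ofReal ?_
  rw [abs_mul, abs_of_nonneg (by positivity), ← mul_assoc, mul_one_div_cancel hκ.ne', one_mul]
  simp only [J, Finset.sum_map, Function.Embedding.coeFn_mk]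
  exact le_abs_self _

theorem variance_le_of_varianceTerm_le {K n : ℕ} (hK : 0 < K) (hn : 0 < n) {r : ℝ}
    (h : ENNReal.ofReal √1536 * varianceTerm ℓ P F fs Pr Z I (K * n) K r ≤ ENNReal.ofReal (r ^ 2))
    {i : Fin N} (hi : i ∈ I) {f : 𝒳 → ℝ} (hf : f ∈ localClass ℓ P F fs r) :
    variance (lossDiff ℓ f fs) (Pr.map (Z i)) ≤ n * (r ^ 4 / 1536) := by
  have hK' : (0 : ℝ) < K := by exact_mod_cast hK
  have hn' : (0 : ℝ) < n := by exact_mod_cast hn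
  set V := variance (lossDiff ℓ f fs) (Pr.map (Z i))
  have h1 : ENNReal.ofReal (√V * √((K : ℝ) / (K * n : ℕ))) ≤
      varianceTerm ℓ P F fs Pr Z I (K * n) K r := by
    unfold varianceTerm
    exact le_iSup₂_of_le i hi (le_iSup₂_of_le f hf le_rfl)
  have h2 := (mul_le_mul_right h1 (ENNReal.ofReal √1536)).trans h
  rw [← ENNReal.ofReal_mul (by positivity), ENNReal.ofReal_le_ofReal_iff (by positivity)] at h2
  have hV : 0 ≤ V := variance_nonneg _ _
  have hKn : (K : ℝ) / (K * n : ℕ) = 1 / n := by push_cast; field_simp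
  rw [hKn] at h2
  have h3 := pow_le_pow_left₀ (by positivity) h2 2
  rw [mul_pow, mul_pow, Real.sq_sqrt (by norm_num), Real.sq_sqrt hV,
    Real.sq_sqrt (by positivity)] at h3
  have h4 : 1536 * (V * (1 / n)) = 1536 * V / n := by ring
  rw [h4, div_le_iff₀ hn'] at h3
  linarith [h3, (by ring : (r ^ 2) ^ 2 * (n : ℝ) = n * r ^ 4)]

/-- Since the blocks are disjoint, each outlier spoils at most one of them. -/
theorem card_disjoint_blocks {K : ℕ} (B : Fin K → Finset (Fin N))
    (hB : ∀ k l, k ≠ l → Disjoint (B k) (B l)) (O : Finset (Fin N)) :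
    K ≤ (Finset.univ.filter fun k => Disjoint (B k) O).card + O.card := by
  have h1 := Finset.card_filter_add_card_filter_not (s := (Finset.univ : Finset (Fin K)))
    (fun k => Disjoint (B k) O)
  rw [Finset.card_univ, Fintype.card_fin] at h1
  have h2 : (Finset.univ.filter fun k => ¬ Disjoint (B k) O).card ≤ O.card := by
    have hex : ∀ k ∈ Finset.univ.filter fun k => ¬ Disjoint (B k) O, ∃ i ∈ O, i ∈ B k := by
      intro k hk
      obtain ⟨i, h1, h2⟩ := Finset.not_disjoint_iff.1 (Finset.mem_filter.1 hk).2
      exact ⟨i, h2, h1⟩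
    refine Finset.card_le_card_of_forall_subsingleton (fun k i => i ∈ B k) hex ?_
    rintro i - k ⟨-, hk⟩ l ⟨-, hl⟩
    by_contra hkl
    exact Finset.disjoint_left.1 (hB k l hkl) hk hl
  omega

theorem exists_event_of_radius [IsProbabilityMeasure Pr] [IsProbabilityMeasure P]
    {Ybar : Set ℝ} {L : ℝ} (hL : 0 < L)
    (hlip : ∀ y, ∀ u ∈ Ybar, ∀ v ∈ Ybar, |ℓ u y - ℓ v y| ≤ L * |u - v|)
    (hconv : ∀ y, ConvexOn ℝ Ybar fun u => ℓ u y)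
    (hF : Convex ℝ F) (hFY : ∀ f ∈ F, ∀ x, f x ∈ Ybar)
    (hℓm : ∀ f ∈ F, Measurable fun z : 𝒳 × 𝒴 => ℓ (f z.1) z.2)
    (hfs : IsOracle ℓ P F fs) (hsep : IsSeparableClass ℓ P F fs)
    (O : Finset (Fin N)) (hZm : ∀ i ∈ Oᶜ, Measurable (Z i))
    (hindep : iIndepFun (fun (i : {i : Fin N // i ∈ Oᶜ}) => Z i) Pr)
    (hL2 : ∀ i ∈ Oᶜ, ∀ f ∈ F, MemLp (fun z : 𝒳 × 𝒴 => f z.1) 2 (Pr.map (Z i)))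
    (hrisk : ∀ i ∈ Oᶜ, ∀ f ∈ F, excessRisk ℓ (Pr.map (Z i)) fs f = excessRisk ℓ P fs f)
    {K : ℕ} (hK0 : 0 < K) (hKO : 7 * (O.card : ℝ) / 3 ≤ K) (hKN : K ≤ N)
    (B : Fin K → Finset (Fin N)) (hBdisj : ∀ k l, k ≠ l → Disjoint (B k) (B l))
    (hBcard : ∀ k, (B k).card = N / K)
    (med : (Fin K → ℝ) → ℝ) (hmed : ∀ x, IsMedian x (med x)) {r : ℝ} (hr : 0 < r)
    (hcond : max (rademacherTerm ℓ P F fs Pr Z (Oᶜ ∩ Finset.univ.biUnion B)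
        (Finset.univ.biUnion B).card r / ENNReal.ofReal (1 / (768 * L)))
      (ENNReal.ofReal √1536 * varianceTerm ℓ P F fs Pr Z (Oᶜ ∩ Finset.univ.biUnion B)
        (Finset.univ.biUnion B).card K r) ≤ ENNReal.ofReal (r ^ 2)) :
    ∃ A : Set Ω, MeasurableSet A ∧
      ENNReal.ofReal (1 - Real.exp (-(K : ℝ) / 2016)) ≤ Pr A ∧
      ∀ ω ∈ A, ∀ fhat : 𝒳 → ℝ, IsMinmaxMOM med B ℓ F (fun i => Z i ω) fhat →
        excessRisk ℓ P fs fhat ≤ r ^ 2 := by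
  have hr2 : 0 < r ^ 2 := pow_pos hr 2
  have hK' : (0 : ℝ) < K := by exact_mod_cast hK0
  obtain ⟨F₀, hF₀, hF₀c, happrox⟩ := hsep
  set n := N / K with hn_def
  have hn : 0 < n := Nat.div_pos hKN hK0
  have hn' : (0 : ℝ) < n := by exact_mod_cast hn
  have hU : (Finset.univ.biUnion B).card = K * n := by
    rw [Finset.card_biUnion fun k _ l _ h => hBdisj k l h]
    simp [hBcard]
  rw [hU] at hcond
  obtain ⟨hcR, hcV⟩ := max_le_iff.1 hcond
  set 𝒦 := Finset.univ.filter fun k => Disjoint (B k) O with h𝒦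
  set m := 𝒦.card with hm_def
  have hm1 : 4 / 7 * (K : ℝ) ≤ m := by
    have : (K : ℝ) ≤ m + O.card := by exact_mod_cast card_disjoint_blocks B hBdisj O
    linarith
  have hm' : (0 : ℝ) < m := lt_of_lt_of_le (by positivity) hm1
  have hm0 : 0 < m := by exact_mod_cast hm'
  let ek : Fin m ≃ 𝒦 := 𝒦.equivFin.symm
  let ej : ∀ k, Fin n ≃ B k := fun k => ((B k).equivFinOfCardEq (hBcard k)).symm
  let idx : Fin m × Fin n → Fin N := fun p => ej (ek p.1) p.2
  have hidxB : ∀ p, idx p ∈ B (ek p.1) := fun p => (ej (ek p.1) p.2).2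
  have hidx : Function.Injective idx := by
    rintro ⟨k, j⟩ ⟨k', j'⟩ h
    have hk : k = k' := by
      by_contra hne
      have h1 : (ek k : Fin K) ≠ ek k' := fun h2 => hne (ek.injective (Subtype.ext h2))
      refine Finset.disjoint_left.1 (hBdisj _ _ h1) (hidxB (k, j)) ?_
      rw [h]; exact hidxB (k', j')
    subst hk
    have hj : j = j' := (ej (ek k)).injective (Subtype.ext h)
    rw [hj]
  have hidxO : ∀ p, idx p ∈ Oᶜ := fun p => by
    have := (Finset.mem_filter.1 (ek p.1).2).2
    exact Finset.mem_compl.2 (Finset.disjoint_left.1 this (hidxB p))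
  have hidxI : ∀ p, idx p ∈ Oᶜ ∩ Finset.univ.biUnion B := fun p =>
    Finset.mem_inter.2 ⟨hidxO p, Finset.mem_biUnion.2 ⟨_, Finset.mem_univ _, hidxB p⟩⟩
  have hp₀ : Nonempty (Fin m × Fin n) := ⟨(⟨0, hm0⟩, ⟨0, hn⟩)⟩
  have hprob : ∀ p, IsProbabilityMeasure (Pr.map (Z (idx p))) := fun p =>
    Measure.isProbabilityMeasure_map (hZm _ (hidxO p)).aemeasurable
  -- Continuity is obtained from the law of a clean inlier, since `F` is not assumed integrable
  -- under `P`.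
  have hcont : ∀ f ∈ F,
      ContinuousOn (fun t => excessRisk ℓ P fs (segPt fs f t)) (Set.Icc 0 1) := fun f hf => by
    obtain ⟨p⟩ := hp₀
    exact continuousOn_excessRisk_segPt hlip hF hFY hfs.mem hℓm
      (fun g hg => (hL2 _ (hidxO p) g hg).integrable (by norm_num)) (hrisk _ (hidxO p)) hf
  -- `fs` is added as the base point where all processes vanish, as contraction requires; it need
  -- not belong to `F₀`.
  let T := insert fs (F₀ ∩ localClass ℓ P F fs r)
  have hTc : Countable T := ((hF₀c.mono Set.inter_subset_left).insert fs).to_subtype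
  have hTloc : ∀ t : T, (t : 𝒳 → ℝ) ∈ localClass ℓ P F fs r := by
    rintro ⟨f, rfl | hf⟩
    · exact ⟨hfs.mem, by rw [excessRisk_self]; exact hr2.le⟩
    · exact hf.2
  have hldm : ∀ f ∈ F, Measurable (lossDiff ℓ f fs) := fun f hf =>
    (hℓm f hf).sub (hℓm fs hfs.mem)
  have hld2 : ∀ p, ∀ f ∈ F, MemLp (lossDiff ℓ f fs) 2 (Pr.map (Z (idx p))) := fun p f hf => by
    refine MemLp.of_le_mul (c := L) ((hL2 _ (hidxO p) f hf).sub (hL2 _ (hidxO p) fs hfs.mem))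
      (hldm f hf).aestronglyMeasurable (ae_of_all _ fun z => ?_)
    exact hlip z.2 _ (hFY f hf _) _ (hFY fs hfs.mem _)
  have key := measure_many_bad_blocks_le hm0 hn (fun p => Z (idx p)) (fun p => hZm _ (hidxO p))
    (hindep.precomp (g := fun p => ⟨idx p, hidxO p⟩) fun p q h => hidx (Subtype.ext_iff.1 h))
    (T := T) (fun t => lossDiff ℓ t fs) (fun t z => (t : 𝒳 → ℝ) z.1 - fs z.1)
    ⟨fs, Set.mem_insert _ _⟩ (fun t => hldm _ (hTloc t).1) hL
    (fun s t z => by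
      rw [sub_sub_sub_cancel_right]
      exact abs_lossDiff_sub_le hlip hFY (hTloc s).1 (hTloc t).1 fs z)
    (by ext z; simp [lossDiff]) (by ext z; simp)
    (fun t p => (hld2 p _ (hTloc t).1).comp_of_map (hZm _ (hidxO p)).aemeasurable)
    (fun t => excessRisk ℓ P fs t) (excessRisk_self fs)
    (fun t p => by
      rw [← hrisk _ (hidxO p) _ (hTloc t).1]
      exact (integral_map (hZm _ (hidxO p)).aemeasurable
        (hldm _ (hTloc t).1).aestronglyMeasurable).symm)
    hr
    (fun t p => by
      have := variance_le_of_varianceTerm_le hK0 hn hcV (hidxI p) (hTloc t)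
      rwa [variance_map (hldm _ (hTloc t).1).aemeasurable (hZm _ (hidxO p)).aemeasurable] at this)
    (by
      -- The clean sample has `m n ≥ (4/7) K n` points, more than half of the retained data, so it
      -- is an admissible `J`.
      refine (lintegral_signs_le_rademacherTerm idx hidx hidxI (n₀ := K * n) ?_
        (fun t : T => (t : 𝒳 → ℝ)) hTloc).trans ?_
      · simp only [Fintype.card_prod, Fintype.card_fin]
        push_cast
        nlinarith
      · rw [ENNReal.div_le_iff (by simpa using hL) ENNReal.ofReal_ne_top,
          ← ENNReal.ofReal_mul hr2.le] at hcR
        refine (mul_le_mul_right hcR _).trans (le_of_eq ?_)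
        simp only [Fintype.card_prod, Fintype.card_fin]
        rw [← ENNReal.ofReal_natCast, ← ENNReal.ofReal_mul (by positivity)]
        congr 1
        push_cast
        ring)
  set bad : Set Ω := {ω | ∃ t : T, 3 / 32 * (m : ℝ) ≤ (Finset.univ.filter fun k =>
        r ^ 2 / 4 < |(∑ j, lossDiff ℓ t fs (Z (idx (k, j)) ω)) / n -
          excessRisk ℓ P fs t|).card} with hbad_def
  have hbadm : MeasurableSet bad := by
    have : bad = ⋃ t : T, {ω | 3 / 32 * (m : ℝ) ≤ (Finset.univ.filter fun k =>
        r ^ 2 / 4 < |(∑ j, lossDiff ℓ t fs (Z (idx (k, j)) ω)) / n -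
          excessRisk ℓ P fs t|).card} := by
      ext ω; simp [hbad_def]
    rw [this]
    refine MeasurableSet.iUnion fun t => measurableSet_le measurable_const ?_
    simp only [Finset.card_filter, Nat.cast_sum, Nat.cast_ite, Nat.cast_one, Nat.cast_zero]
    refine Finset.measurable_fun_sum _ fun k _ => Measurable.ite ?_ measurable_const
      measurable_const
    refine measurableSet_lt measurable_const ?_
    have hmj : ∀ j, Measurable fun ω => lossDiff ℓ t fs (Z (idx (k, j)) ω) := fun j =>
      (hldm _ (hTloc t).1).comp (hZm _ (hidxO _))
    exact (((Finset.measurable_fun_sum _ fun j _ => hmj j).div_const _).sub_const _).abs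
  refine ⟨badᶜ, hbadm.compl, ?_, ?_⟩
  · rw [prob_compl_eq_one_sub hbadm, ENNReal.ofReal_sub _ (Real.exp_pos _).le, ENNReal.ofReal_one]
    refine tsub_le_tsub_left (key.trans (ENNReal.ofReal_le_ofReal (Real.exp_le_exp.2 ?_))) 1
    -- `m / 1152 ≥ (4/7) K / 1152 = K / 2016`.
    linarith
  · intro ω hω fhat hfhat
    refine excessRisk_le_of_mostBlocksGood hconv hF hFY hfs hcont hr
      (mostBlocksGood_of_countable hlip hconv hF hFY hfs hcont hF₀ happrox hr fun f hf => ?_)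
      hmed hfhat
    have hω' : ∀ t : T, ((Finset.univ.filter fun k =>
        r ^ 2 / 4 < |(∑ j, lossDiff ℓ t fs (Z (idx (k, j)) ω)) / n -
          excessRisk ℓ P fs t|).card : ℝ) < 3 / 32 * (m : ℝ) := fun t => by
      by_contra h
      exact hω ⟨t, not_lt.1 h⟩
    have hfb := hω' ⟨f, Set.mem_insert_of_mem _ hf⟩
    simp only at hfb
    have hmean : ∀ k, (∑ j, lossDiff ℓ f fs (Z (idx (k, j)) ω)) / n =
        blockMean (B (ek k)) (fun i => Z i ω) (lossDiff ℓ f fs) := fun k => by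
      unfold blockMean
      rw [hBcard, ← Finset.sum_coe_sort (B (ek k)), ← Equiv.sum_comp (ej (ek k))]
    simp only [hmean] at hfb
    have hsplit := Finset.card_filter_add_card_filter_not (s := (Finset.univ : Finset (Fin m)))
      fun k => r ^ 2 / 4 < |blockMean (B (ek k)) (fun i => Z i ω) (lossDiff ℓ f fs) -
        excessRisk ℓ P fs f|
    rw [Finset.card_univ, Fintype.card_fin] at hsplit
    have hsub : (Finset.univ.filter fun k : Fin m => ¬ r ^ 2 / 4 <
        |blockMean (B (ek k)) (fun i => Z i ω) (lossDiff ℓ f fs) - excessRisk ℓ P fs f|).card ≤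
        (Finset.univ.filter fun k : Fin K => |blockMean (B k) (fun i => Z i ω) (lossDiff ℓ f fs) -
          excessRisk ℓ P fs f| ≤ r ^ 2 / 4).card := by
      refine Finset.card_le_card_of_injOn (fun k => (ek k : Fin K)) ?_ ?_
      · intro k hk
        simpa using hk
      · intro a _ b _ h
        exact ek.injective (Subtype.ext h)
    unfold MostBlocksGood
    have hsplit' : ((Finset.univ.filter fun k : Fin m => r ^ 2 / 4 <
        |blockMean (B (ek k)) (fun i => Z i ω) (lossDiff ℓ f fs) - excessRisk ℓ P fs f|).card : ℝ) +
        ((Finset.univ.filter fun k : Fin m => ¬ r ^ 2 / 4 <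
        |blockMean (B (ek k)) (fun i => Z i ω) (lossDiff ℓ f fs) - excessRisk ℓ P fs f|).card : ℝ)
        = m := by exact_mod_cast hsplit
    have hsub' : ((Finset.univ.filter fun k : Fin m => ¬ r ^ 2 / 4 <
        |blockMean (B (ek k)) (fun i => Z i ω) (lossDiff ℓ f fs) -
          excessRisk ℓ P fs f|).card : ℝ) ≤
        ((Finset.univ.filter fun k : Fin K => |blockMean (B k) (fun i => Z i ω)
          (lossDiff ℓ f fs) - excessRisk ℓ P fs f| ≤ r ^ 2 / 4).card : ℝ) := by
      exact_mod_cast hsub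
    -- More than `(29/32) m` blocks are good, and `2 (29/32) (4/7) = 29/28 > 1`.
    have hfinal : (K : ℝ) < 2 * ((Finset.univ.filter fun k : Fin K =>
        |blockMean (B k) (fun i => Z i ω) (lossDiff ℓ f fs) -
          excessRisk ℓ P fs f| ≤ r ^ 2 / 4).card : ℝ) := by linarith
    exact_mod_cast hfinal

end Assembly

end MinmaxMOM

end

/-- `P` is the target distribution, `Z i` are the observations, `O` is the set of outliers and `Oᶜ`
the set of inliers. The blocks `B k` have the same size `⌊N / K⌋`; the data outside the blocks are
discarded (there are none if `K` divides `N`), and the complexity is that of the retained sample.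
Nothing is assumed on `Z i` for `i ∈ O`, not even measurability. -/
theorem theorem4p1 {Ω 𝒳 𝒴 : Type*} [MeasurableSpace Ω] [MeasurableSpace 𝒳] [MeasurableSpace 𝒴]
    (Pr : Measure Ω) [IsProbabilityMeasure Pr] (P : Measure (𝒳 × 𝒴)) [IsProbabilityMeasure P]
    -- the loss: convex and `L`-Lipschitz in its first argument
    (Ybar : Set ℝ) (hYbar : Convex ℝ Ybar) (ℓ : ℝ → 𝒴 → ℝ) (L : ℝ) (hL : 0 < L)
    (hlip : ∀ y, ∀ u ∈ Ybar, ∀ v ∈ Ybar, |ℓ u y - ℓ v y| ≤ L * |u - v|)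
    (hconv : ∀ y, ConvexOn ℝ Ybar fun u => ℓ u y)
    -- the class: convex, made of measurable functions with values in `Ybar`
    (F : Set (𝒳 → ℝ)) (hF : Convex ℝ F) (hFY : ∀ f ∈ F, ∀ x, f x ∈ Ybar)
    (hFm : ∀ f ∈ F, Measurable f)
    (hℓm : ∀ f ∈ F, Measurable fun z : 𝒳 × 𝒴 => ℓ (f z.1) z.2)
    (fs : 𝒳 → ℝ) (hfs : MinmaxMOM.IsOracle ℓ P F fs)
    (hsep : MinmaxMOM.IsSeparableClass ℓ P F fs)
    -- the data: independent inliers that define the same excess risk as `P`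
    (N : ℕ) (Z : Fin N → Ω → 𝒳 × 𝒴) (O : Finset (Fin N))
    (hZm : ∀ i ∈ Oᶜ, Measurable (Z i))
    (hindep : iIndepFun (fun (i : {i : Fin N // i ∈ Oᶜ}) => Z i) Pr)
    (hL2 : ∀ i ∈ Oᶜ, ∀ f ∈ F, MemLp (fun z : 𝒳 × 𝒴 => f z.1) 2 (Pr.map (Z i)))
    (hrisk : ∀ i ∈ Oᶜ, ∀ f ∈ F,
      MinmaxMOM.excessRisk ℓ (Pr.map (Z i)) fs f = MinmaxMOM.excessRisk ℓ P fs f)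
    (hO : (O.card : ℝ) ≤ 3 * N / 7)
    -- the blocks and the median
    (K : ℕ) (hK0 : 0 < K) (hKO : 7 * (O.card : ℝ) / 3 ≤ K) (hKN : K ≤ N)
    (B : Fin K → Finset (Fin N)) (hBdisj : ∀ k l, k ≠ l → Disjoint (B k) (B l))
    (hBcard : ∀ k, (B k).card = N / K)
    (med : (Fin K → ℝ) → ℝ) (hmed : ∀ x, MinmaxMOM.IsMedian x (med x))
    -- the complexity parameter, for the retained sample
    (rbar : ℝ) (hrbar0 : 0 ≤ rbar)
    (hrbar : MinmaxMOM.complexityInf ℓ P F fs Pr Z (Oᶜ ∩ Finset.univ.biUnion B)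
      (Finset.univ.biUnion B).card K (1 / (768 * L)) ≤ ENNReal.ofReal rbar) :
    ∃ A : Set Ω, MeasurableSet A ∧
      ENNReal.ofReal (1 - Real.exp (-(K : ℝ) / 2016)) ≤ Pr A ∧
      ∀ ω ∈ A, ∀ fhat : 𝒳 → ℝ, MinmaxMOM.IsMinmaxMOM med B ℓ F (fun i => Z i ω) fhat →
        MinmaxMOM.excessRisk ℓ P fs fhat ≤ rbar ^ 2 := by
  -- The infimum need not be attained, so an admissible radius below `rbar + 1 / (n + 1)` is chosen
  -- for each `n`. The events need not be nested; on their limsup the bound holds for infinitely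
  -- many `n`, which is enough to pass to the limit.
  have hex : ∀ n : ℕ, ∃ r : ℝ, 0 < r ∧ r < rbar + 1 / ((n : ℝ) + 1) ∧ ∃ A : Set Ω,
      MeasurableSet A ∧ ENNReal.ofReal (1 - Real.exp (-(K : ℝ) / 2016)) ≤ Pr A ∧
      ∀ ω ∈ A, ∀ fhat : 𝒳 → ℝ, MinmaxMOM.IsMinmaxMOM med B ℓ F (fun i => Z i ω) fhat →
        MinmaxMOM.excessRisk ℓ P fs fhat ≤ r ^ 2 := by
    intro n
    have hpos : 0 < rbar + 1 / ((n : ℝ) + 1) := by positivity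
    have hlt := hrbar.trans_lt ((ENNReal.ofReal_lt_ofReal_iff hpos).2
      (lt_add_of_pos_right rbar (by positivity : 0 < 1 / ((n : ℝ) + 1))))
    simp only [MinmaxMOM.complexityInf, iInf_lt_iff] at hlt
    obtain ⟨r, hr, hcond, hlt⟩ := hlt
    exact ⟨r, hr, (ENNReal.ofReal_lt_ofReal_iff hpos).1 hlt,
      MinmaxMOM.exists_event_of_radius hL hlip hconv hF hFY hℓm hfs hsep O hZm hindep hL2 hrisk
        hK0 hKO hKN B hBdisj hBcard med hmed hr hcond⟩
  choose r hr0 hr A hAm hAP hA using hex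
  refine ⟨limsup A atTop, MeasurableSet.measurableSet_limsup hAm,
    MinmaxMOM.measure_limsup_ge hAm hAP, fun ω hω fhat hfhat => ?_⟩
  have hfreq : ∃ᶠ n in atTop, ω ∈ A n := mem_limsup_iff_frequently_mem.1 hω
  have hlim : Tendsto (fun n : ℕ => (rbar + 1 / ((n : ℝ) + 1)) ^ 2) atTop (𝓝 (rbar ^ 2)) := by
    have h := ((tendsto_const_nhds (x := rbar)).add
      (tendsto_one_div_add_atTop_nhds_zero_nat (𝕜 := ℝ))).pow 2
    rwa [add_zero] at h
  refine ge_of_tendsto_of_frequently hlim (hfreq.mono fun n hn => ?_)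
  exact (hA n ω hn fhat hfhat).trans (pow_le_pow_left₀ (hr0 n).le (hr n).le 2)
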